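/- Let $\mathcal P\subset\mathbb R^2$ be a closed polygonal environment, possibly with holes (a closed set whose boundary is a finite union of segments). For $r>0$ let $\mathcal F^{(r)}(\mathcal P)$ be the set of all points $p$ such that the closed axis-aligned square of radius $r$ (side length $2r$) centered at $p$ is contained in $\mathcal P$, and let $\mathcal F=\mathcal F^{(1)}(\mathcal P)$. A vertex of $\mathcal F$ is a boundary point of $\mathcal F$ near which $\partial\mathcal F$ is not a straight line; an edge of $\mathcal F$ is a segment contained in $\partial\mathcal F$ that joins two distinct vertices and has no vertex in its relative interior. For configurations $\mathbf s,\mathbf t\in(\mathbb R^2)^k$, an $(\mathbf s,\mathbf t)$-plan is a continuous map $\pi=(\pi_1,\dots,\pi_k):[0,T]\to\mathcal P^k$ with $T\ge 0$, $\pi(0)=\mathbf s$ and $\pi(T)=\mathbf t$. It is feasible for radius $r$ if at all times $\pi_i\in\mathcal F^{(r)}(\mathcal P)$ for all $i$ and $\|\pi_i-\pi_j\|_\infty\ge 2r$ for all $i\ne j$; it is feasible if it is feasible for radius $1$. Its cost is $\mathrm{cost}(\pi)=\sum_{i=1}^k|\pi_i|$, the sum of the Euclidean arc lengths of the $k$ paths,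 and $\mathrm{OPT}(\mathbf s,\mathbf t,r)$ is the least cost of an $(\mathbf s,\mathbf t)$-plan that is feasible for radius $r$. For $\rho>0$ the pair $(\mathbf s,\mathbf t)$ is $\rho$-reachable if there is a feasible $(\mathbf s,\mathbf t)$-plan that is also feasible for radius $1+\rho$. For a piecewise-linear plan $\pi$ (piecewise affine as a map to $\mathbb R^{2k}$), $\beta(\pi)$ denotes the number of its breakpoints, that is, of its vertices, both end points included. **Corollary.** For every constant $c\ge 1$ there is a function $f=f_c:\mathbb N\to\mathbb R_{\ge 0}$ that is at most exponential ($f(k)\le A\cdot B^k$ for all $k$, with constants $A,B$ that depend only on $c$) such that the following holds for all $k$, all $\rho>0$, all closed polygonal environments $\mathcal P$ and all $\mathbf s,\mathbf t\in(\mathbb R^2)^k$. If every edge of $\mathcal F$ has length at least $1/c$ and $(\mathbf s,\mathbf t)$ is $\rho$-reachable, then there is a feasible piecewise-linear $(\mathbf s,\mathbf t)$-plan $\pi'$ with $$\mathrm{cost}(\pi')\le\mathrm{OPT}(\mathbf s,\mathbf t,1+\rho)\qquad\text{and}\qquad \beta(\pi')\le f(k)\cdot(\mathrm{cost}(\pi')+1).$$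 In particular, $f$ does not depend on $\rho$, on $\mathcal P$ or on $\mathbf s,\mathbf t$. -/

import Mathlib

open Set Filter Topology
open scoped ENNReal NNReal

noncomputable section

namespace SquareRobots

/-- The plane with its Euclidean norm. -/
abbrev Plane : Type := EuclideanSpace ℝ (Fin 2)

/-- A configuration of `k` robots: the positions of their centers. -/
abbrev Config (k : ℕ) : Type := Fin k → Plane

/-- A closed polygonal environment, possibly with holes: a closed set whose boundary is a finite
union of segments. -/
def IsPolygonalEnvironment (P : Set Plane) : Prop :=
  IsClosed P ∧ ∃ S : Finset (Plane × Plane), frontier P = ⋃ e ∈ S, segment ℝ e.1 e.2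

/-- The distance of the plane in the maximum norm. -/
def supDist (p q : Plane) : ℝ := max |p 0 - q 0| |p 1 - q 1|

/-- The free space of one axis-aligned square robot of radius `r` (side length `2 * r`): the
placements for which the closed square of radius `r` around the center is contained in `P`. -/
def freeSpace (P : Set Plane) (r : ℝ) : Set Plane :=
  {p | ∀ q, supDist p q ≤ r → q ∈ P}

/-- The free configurations of `k` squares of radius `r`: no square leaves `P`, and the interiors
of different squares are disjoint. -/
def freeConfigs (P : Set Plane) (k : ℕ) (r : ℝ) : Set (Config k) :=
  {p | (∀ i, p i ∈ freeSpace P r) ∧ ∀ i j, i ≠ j → 2 * r ≤ supDist (p i) (p j)}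

/-- `π`, restricted to the time interval `[0, T]`, is an `(s, t)`-plan in `P`. -/
structure IsPlan (P : Set Plane) {k : ℕ} (s t : Config k) (T : ℝ) (π : ℝ → Config k) : Prop where
  nonneg : 0 ≤ T
  continuousOn : ContinuousOn π (Icc 0 T)
  mem : ∀ τ ∈ Icc 0 T, ∀ i, π τ i ∈ P
  source : π 0 = s
  target : π T = t

/-- `π` is an `(s, t)`-plan that is feasible for squares of radius `r`. -/
def IsFeasiblePlan (P : Set Plane) {k : ℕ} (r : ℝ) (s t : Config k) (T : ℝ)
    (π : ℝ → Config k) : Prop :=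
  IsPlan P s t T π ∧ ∀ τ ∈ Icc 0 T, π τ ∈ freeConfigs P k r

/-- A `ρ`-robust plan of unit squares: it is also feasible for squares of radius `1 + ρ`. -/
def IsRobustPlan (P : Set Plane) {k : ℕ} (ρ : ℝ) (s t : Config k) (T : ℝ)
    (π : ℝ → Config k) : Prop :=
  IsFeasiblePlan P 1 s t T π ∧ IsFeasiblePlan P (1 + ρ) s t T π

/-- The pair `(s, t)` is `ρ`-reachable. -/
def IsRobustlyReachable (P : Set Plane) {k : ℕ} (ρ : ℝ) (s t : Config k) : Prop :=
  ∃ (T : ℝ) (π : ℝ → Config k), IsRobustPlan P ρ s t T π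

/-- The cost of a plan: the sum of the (Euclidean) arc lengths of the paths of the robots. -/
def cost {k : ℕ} (T : ℝ) (π : ℝ → Config k) : ℝ≥0∞ :=
  ∑ i, eVariationOn (fun τ => π τ i) (Icc 0 T)

/-- The least cost of a feasible `(s, t)`-plan of squares of radius `r`
(`∞` if there is no feasible plan). -/
def opt (P : Set Plane) {k : ℕ} (s t : Config k) (r : ℝ) : ℝ≥0∞ :=
  ⨅ (T : ℝ) (π : ℝ → Config k) (_ : IsFeasiblePlan P r s t T π), cost T π

/-- The plan `π` is piecewise linear on `[0, T]`: there are times `0 = τ 0 ≤ ⋯ ≤ τ N = T` such that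
`π` is affine on each interval `[τ i, τ (i + 1)]`. -/
def IsPiecewiseLinear {k : ℕ} (T : ℝ) (π : ℝ → Config k) : Prop :=
  ∃ (N : ℕ) (τ : ℕ → ℝ), Monotone τ ∧ τ 0 = 0 ∧ τ N = T ∧
    ∀ i < N, ∃ a v : Config k, ∀ x ∈ Icc (τ i) (τ (i + 1)), π x = a + x • v

/-- The times of the breakpoints (vertices) of a plan: both end points, and the times around which
the plan is not affine. -/
def breakpoints {k : ℕ} (T : ℝ) (π : ℝ → Config k) : Set ℝ :=
  {τ | τ ∈ Icc 0 T ∧ (τ = 0 ∨ τ = T ∨ ¬ ∃ a v : Config k, ∀ᶠ x in 𝓝 τ, π x = a + x • v)}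

/-- The number of breakpoints of a plan (`∞` if there are infinitely many). -/
def numBreakpoints {k : ℕ} (T : ℝ) (π : ℝ → Config k) : ℕ∞ := (breakpoints T π).encard

/-- The vertices of a polygonal set `F`: the boundary points near which the boundary is not
a straight line. -/
def vertices (F : Set Plane) : Set Plane :=
  {v | v ∈ frontier F ∧
    ¬ ∃ d : Plane, d ≠ 0 ∧ ∀ᶠ x in 𝓝 v, x ∈ frontier F ↔ ∃ l : ℝ, x = v + l • d}

/-- The segment between `a` and `b` is an edge of the polygonal set `F`: it joins two different
vertices along the boundary and contains no further vertex. -/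
def IsEdge (F : Set Plane) (a b : Plane) : Prop :=
  a ≠ b ∧ a ∈ vertices F ∧ b ∈ vertices F ∧ openSegment ℝ a b ⊆ frontier F \ vertices F

end SquareRobots

end

namespace SquareRobots

/-! ### The maximum norm -/

/-! The radius slack `ρ` is used only to turn a plan into a polyline of free unit-square
configurations: sampling it finely enough costs nothing and keeps all chords free
(`IsFeasiblePlan.exists_polyline`). The number of samples is uncontrolled, so the polyline is then
shortcut. With `δ = 1 / (4 * c)`, the claim is that a stretch of cost at most `δ` with `2 * L`
segments, where `L` is exponential in `k`, contains two vertices at least two segments apart whose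
chord is free. When no shortcut is left, every such stretch costs more than `δ`, which bounds the
number of segments by a multiple of cost plus one.

The shortcut comes from the pigeonhole principle: the configurations of a short connected stretch
`K` are coloured with `L` colours so that equal colours see each other
(`exists_coloring_freeConfigs`). For pairs of robots the colour records an axis direction in which
they are separated by 2, a condition that survives convex combinations. A packing argument leaves at
most 25 grid cells, each with at most one robot, to be recorded per robot.

For one robot against the obstacles, the forbidden region near `K` splits into four parts, one per
corner orientation, each a union of parallel quadrants. In diagonal coordinates such a part lies
below the graph of a 1-Lipschitz function. If a chord between points of `K` enters it, the graph has
a bend above the chord (`exists_bend`). Because `K` is connected, it must pass along the graph, so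
no other obstacle interferes there and the graph is part of the boundary of the free space
(`mem_frontier_of_between`). The bend is thus a vertex. Two such vertices would span an edge shorter
than `4 * δ`; hence there is at most one per orientation, and one bit, the side of that vertex,
decides visibility (`exists_separator`).

Finally, the bound on the number of segments makes the relevant polylines a compact family, so the
infimum over robust plans is itself met (`exists_polyline_cost_le`). -/

theorem abs_sub_zero_le_supDist (p q : Plane) : |p 0 - q 0| ≤ supDist p q := le_max_left _ _

theorem abs_sub_one_le_supDist (p q : Plane) : |p 1 - q 1| ≤ supDist p q := le_max_right _ _

theorem supDist_self (p : Plane) : supDist p p = 0 := by simp [supDist]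

theorem supDist_comm (p q : Plane) : supDist p q = supDist q p := by
  simp [supDist, abs_sub_comm]

theorem supDist_le_iff {p q : Plane} {r : ℝ} :
    supDist p q ≤ r ↔ |p 0 - q 0| ≤ r ∧ |p 1 - q 1| ≤ r := max_le_iff

theorem supDist_triangle (p q x : Plane) : supDist p x ≤ supDist p q + supDist q x := by
  rw [supDist_le_iff]
  exact ⟨(abs_sub_le _ (q 0) _).trans
      (add_le_add (abs_sub_zero_le_supDist _ _) (abs_sub_zero_le_supDist _ _)),
    (abs_sub_le _ (q 1) _).trans
      (add_le_add (abs_sub_one_le_supDist _ _) (abs_sub_one_le_supDist _ _))⟩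

theorem dist_eq_sqrt (p q : Plane) : dist p q = √((p 0 - q 0) ^ 2 + (p 1 - q 1) ^ 2) := by
  rw [EuclideanSpace.dist_eq, Fin.sum_univ_two, Real.dist_eq, Real.dist_eq, sq_abs, sq_abs]

theorem supDist_le_dist (p q : Plane) : supDist p q ≤ dist p q := by
  rw [supDist_le_iff, dist_eq_sqrt]
  constructor <;> refine Real.abs_le_sqrt ?_ <;>
    nlinarith [sq_nonneg (p 0 - q 0), sq_nonneg (p 1 - q 1)]

theorem dist_lt_of_supDist_le {p q : Plane} {r : ℝ} (hr : 0 < r) (h : supDist p q ≤ r) :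
    dist p q < 2 * r := by
  rw [dist_eq_sqrt, Real.sqrt_lt' (by positivity)]
  obtain ⟨h0, h1⟩ := supDist_le_iff.1 h
  nlinarith [sq_le_sq' (abs_le.1 h0).1 (abs_le.1 h0).2,
    sq_le_sq' (abs_le.1 h1).1 (abs_le.1 h1).2]

theorem continuous_supDist : Continuous fun x : Plane × Plane => supDist x.1 x.2 := by
  unfold supDist
  fun_prop

theorem plane_ext {p q : Plane} (h0 : p 0 = q 0) (h1 : p 1 = q 1) : p = q := by
  ext i
  fin_cases i
  · exact h0
  · exact h1

/-! ### The free space -/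

theorem isClosed_freeSpace {P : Set Plane} (hP : IsClosed P) (r : ℝ) :
    IsClosed (freeSpace P r) := by
  have : freeSpace P r = ⋂ w : {w : Plane // |w 0| ≤ r ∧ |w 1| ≤ r}, (fun p => p + w.1) ⁻¹' P := by
    ext p
    simp only [mem_iInter, mem_preimage]
    constructor
    · rintro h ⟨w, hw0, hw1⟩
      exact h _ (supDist_le_iff.2 (by simpa using ⟨hw0, hw1⟩))
    · intro h q hq
      obtain ⟨h0, h1⟩ := supDist_le_iff.1 hq
      have := h ⟨q - p, by rw [PiLp.sub_apply, abs_sub_comm]; exact h0,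
        by rw [PiLp.sub_apply, abs_sub_comm]; exact h1⟩
      simpa using this
  rw [this]
  exact isClosed_iInter fun w => hP.preimage (by fun_prop)

/-- A subset of the plane given by a nondegenerate linear equation. -/
def IsLine (L : Set Plane) : Prop :=
  ∃ α β κ : ℝ, (α ≠ 0 ∨ β ≠ 0) ∧ L = {p | α * p 0 + β * p 1 = κ}

theorem IsLine.isClosed {L : Set Plane} (h : IsLine L) : IsClosed L := by
  obtain ⟨α, β, κ, -, rfl⟩ := h
  exact isClosed_eq (by fun_prop) continuous_const

/-- A line is spanned by any two of its points. -/
theorem IsLine.subset {L : Set Plane} (h : IsLine L) {p q : Plane} (hp : p ∈ L) (hq : q ∈ L)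
    {x : Plane} (hpq : p ≠ q) (hx : x ∈ L) : ∃ l : ℝ, x = p + l • (q - p) := by
  obtain ⟨α, β, κ, hn, rfl⟩ := h
  simp only [mem_ofPred_eq] at hp hq hx
  have e1 : α * (q 0 - p 0) + β * (q 1 - p 1) = 0 := by linarith
  have e2 : α * (x 0 - p 0) + β * (x 1 - p 1) = 0 := by linarith
  have det : (x 0 - p 0) * (q 1 - p 1) = (x 1 - p 1) * (q 0 - p 0) := by
    rcases hn with hn | hn
    · apply mul_left_cancel₀ hn
      linear_combination (q 1 - p 1) * e2 - (x 1 - p 1) * e1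
    · apply mul_left_cancel₀ hn
      linear_combination (x 0 - p 0) * e1 - (q 0 - p 0) * e2
  by_cases h0 : q 0 - p 0 = 0
  · have h1 : q 1 - p 1 ≠ 0 := fun h1 =>
      hpq (plane_ext (by linarith) (by linarith))
    refine ⟨(x 1 - p 1) / (q 1 - p 1), plane_ext ?_ ?_⟩
    · simp only [PiLp.add_apply, PiLp.smul_apply, PiLp.sub_apply, smul_eq_mul]
      rw [h0] at det ⊢
      have : x 0 - p 0 = 0 := by
        rw [mul_zero] at det
        exact (mul_eq_zero.1 det).resolve_right h1
      linarith
    · simp only [PiLp.add_apply, PiLp.smul_apply, PiLp.sub_apply, smul_eq_mul]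
      field_simp
      ring
  · refine ⟨(x 0 - p 0) / (q 0 - p 0), plane_ext ?_ ?_⟩
    · simp only [PiLp.add_apply, PiLp.smul_apply, PiLp.sub_apply, smul_eq_mul]
      field_simp
      ring
    · simp only [PiLp.add_apply, PiLp.smul_apply, PiLp.sub_apply, smul_eq_mul]
      field_simp
      linarith

theorem IsLine.mem {L : Set Plane} (h : IsLine L) {p q : Plane} (hp : p ∈ L) (hq : q ∈ L)
    (l : ℝ) : p + l • (q - p) ∈ L := by
  obtain ⟨α, β, κ, -, rfl⟩ := h
  simp only [mem_ofPred_eq, PiLp.add_apply, PiLp.smul_apply, PiLp.sub_apply, smul_eq_mul] at *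
  linear_combination (1 - l) * hp + l * hq

theorem IsLine.inter_subsingleton {L M : Set Plane} (hL : IsLine L) (hM : IsLine M)
    (h : L ≠ M) : (L ∩ M).Subsingleton := by
  rintro p ⟨hpL, hpM⟩ q ⟨hqL, hqM⟩
  by_contra hpq
  refine h (Subset.antisymm ?_ ?_)
  · intro x hx
    obtain ⟨l, rfl⟩ := hL.subset hpL hqL hpq hx
    exact hM.mem hpM hqM l
  · intro x hx
    obtain ⟨l, rfl⟩ := hM.subset hpM hqM hpq hx
    exact hL.mem hpL hqL l

/-- A boundary point of `P` in the open square would have a neighbourhood inside `P`. If the closed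
square missed the boundary of `P`, it would be a compact subset of the interior, and small
translates would stay inside, making `p` interior. -/
theorem exists_mem_frontier_supDist_eq {P : Set Plane} (hP : IsClosed P) {r : ℝ} (hr : 0 < r)
    {p : Plane} (hp : p ∈ frontier (freeSpace P r)) :
    (∀ q ∈ frontier P, r ≤ supDist p q) ∧ ∃ q ∈ frontier P, supDist p q = r := by
  have hpF : p ∈ freeSpace P r := (isClosed_freeSpace hP r).frontier_subset hp
  have far : ∀ q ∈ frontier P, r ≤ supDist p q := by
    intro q hq
    by_contra! hlt
    refine hq.2 (mem_interior_iff_mem_nhds.2 ?_)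
    have : ∀ᶠ x in 𝓝 q, supDist p x < r :=
      ((continuous_supDist.comp (by fun_prop : Continuous fun x => (p, x))).tendsto q).eventually_lt
        tendsto_const_nhds hlt
    filter_upwards [this] with x hx using hpF x hx.le
  refine ⟨far, ?_⟩
  by_contra! hne
  have hK : IsCompact {q : Plane | supDist p q ≤ r} := by
    refine Metric.isCompact_of_isClosed_isBounded
      (isClosed_le (continuous_supDist.comp (by fun_prop : Continuous fun x => (p, x)))
        continuous_const) ?_
    refine (Metric.isBounded_ball (x := p) (r := 2 * r)).subset fun q hq => ?_
    rw [Metric.mem_ball, dist_comm]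
    exact dist_lt_of_supDist_le hr hq
  have hsub : {q : Plane | supDist p q ≤ r} ⊆ interior P := by
    intro q hq
    by_contra hq'
    have : q ∈ frontier P := ⟨subset_closure (hpF q hq), hq'⟩
    exact hne q this (le_antisymm hq (far q this))
  obtain ⟨ε, hε, hthick⟩ := hK.exists_thickening_subset_open isOpen_interior hsub
  refine hp.2 (mem_interior_iff_mem_nhds.2 ?_)
  filter_upwards [Metric.ball_mem_nhds p hε] with x hx q hq
  have : q + (p - x) ∈ {q : Plane | supDist p q ≤ r} := by
    rw [mem_ofPred_eq, supDist_le_iff]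
    obtain ⟨h0, h1⟩ := supDist_le_iff.1 hq
    simp only [PiLp.add_apply, PiLp.sub_apply]
    constructor
    · convert h0 using 2; ring
    · convert h1 using 2; ring
  refine interior_subset (hthick (Metric.mem_thickening_iff.2 ⟨_, this, ?_⟩))
  rw [dist_eq_norm, sub_add_cancel_left, norm_neg, ← dist_eq_norm, dist_comm]
  exact hx

/-- The lines through the sides of the Minkowski sum of a segment and the unit square. -/
def sideLines (e : Plane × Plane) : Set (Set Plane) :=
  ((fun x : ℝ × ℝ × ℝ => {p : Plane | x.1 * p 0 + x.2.1 * p 1 = x.2.2}) ''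
    {(1, 0, e.1 0 + 1), (1, 0, e.1 0 - 1), (0, 1, e.1 1 + 1), (0, 1, e.1 1 - 1),
     (1, 0, e.2 0 + 1), (1, 0, e.2 0 - 1), (0, 1, e.2 1 + 1), (0, 1, e.2 1 - 1),
     (e.2 1 - e.1 1, e.1 0 - e.2 0,
      (e.2 1 - e.1 1) * (e.1 0 + 1) + (e.1 0 - e.2 0) * (e.1 1 + 1)),
     (e.2 1 - e.1 1, e.1 0 - e.2 0,
      (e.2 1 - e.1 1) * (e.1 0 + 1) + (e.1 0 - e.2 0) * (e.1 1 - 1)),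
     (e.2 1 - e.1 1, e.1 0 - e.2 0,
      (e.2 1 - e.1 1) * (e.1 0 - 1) + (e.1 0 - e.2 0) * (e.1 1 + 1)),
     (e.2 1 - e.1 1, e.1 0 - e.2 0,
      (e.2 1 - e.1 1) * (e.1 0 - 1) + (e.1 0 - e.2 0) * (e.1 1 - 1))}) ∩ {L | IsLine L}

theorem finite_sideLines (e : Plane × Plane) : (sideLines e).Finite :=
  Finite.inter_of_left (Finite.image _ (by simp)) _

theorem eq_add_or_sub_of_supDist_eq {p q : Plane} (h : supDist p q = 1) :
    (p 0 = q 0 + 1 ∨ p 0 = q 0 - 1) ∨ (p 1 = q 1 + 1 ∨ p 1 = q 1 - 1) := by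
  unfold supDist at h
  rcases max_choice |p 0 - q 0| |p 1 - q 1| with h' | h' <;> rw [h'] at h
  · left
    rcases (abs_eq zero_le_one).1 h with h | h
    · left; linarith
    · right; linarith
  · right
    rcases (abs_eq zero_le_one).1 h with h | h
    · left; linarith
    · right; linarith

theorem isLine_eq_zero (κ : ℝ) : IsLine {p : Plane | (1 : ℝ) * p 0 + 0 * p 1 = κ} :=
  ⟨1, 0, κ, Or.inl one_ne_zero, rfl⟩

theorem isLine_eq_one (κ : ℝ) : IsLine {p : Plane | (0 : ℝ) * p 0 + 1 * p 1 = κ} :=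
  ⟨0, 1, κ, Or.inr one_ne_zero, rfl⟩

theorem exists_near_pos {x d : ℝ} (hd : d ≠ 0) (hx : |x| = 1) :
    ∃ σ : ℝ, |σ| = 1 ∧ ∀ᶠ η in 𝓝[>] (0 : ℝ), |x + η * (σ * d)| < 1 := by
  refine ⟨-(SignType.sign (x * d) : ℝ), ?_, ?_⟩
  · have : x * d ≠ 0 := mul_ne_zero (by intro h; simp [h] at hx) hd
    rcases lt_or_gt_of_ne this with h | h
    · simp [sign_neg h]
    · simp [sign_pos h]
  · have hev : ∀ᶠ η in 𝓝[>] (0 : ℝ), η * |d| < 1 := by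
      have : Tendsto (fun η : ℝ => η * |d|) (𝓝[>] 0) (𝓝 (0 * |d|)) :=
        (Continuous.tendsto (by fun_prop) 0).mono_left nhdsWithin_le_nhds
      rw [zero_mul] at this
      exact this.eventually_lt tendsto_const_nhds one_pos
    filter_upwards [hev, self_mem_nhdsWithin] with η h1 h2
    have h2 : 0 < η := h2
    have hd' : 0 < |d| := abs_pos.2 hd
    have h3 : 0 < η * |d| := by positivity
    rcases (abs_eq zero_le_one).1 hx with rfl | rfl <;> rcases lt_or_gt_of_ne hd with h | h
    · rw [abs_of_neg h] at h1 h3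
      simp [sign_neg h]
      rw [abs_lt]; constructor <;> nlinarith
    · rw [abs_of_pos h] at h1 h3
      simp [sign_pos h]
      rw [abs_lt]; constructor <;> nlinarith
    · rw [abs_of_neg h] at h1 h3
      simp [h]
      rw [abs_lt]; constructor <;> nlinarith
    · rw [abs_of_pos h] at h1 h3
      simp [h]
      rw [abs_lt]; constructor <;> nlinarith

/-- If only one coordinate of the offset is extremal and the segment is transversal to that side of
the square, sliding the contact point along the segment brings it strictly inside. -/
theorem not_far_of_abs_eq {x y d d' t : ℝ} (hd : d ≠ 0) (hx : |x| = 1) (hy : |y| < 1)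
    (ht : t ∈ Ioo (0 : ℝ) 1) :
    ∃ s ∈ Icc (0 : ℝ) 1, |x - (s - t) * d| < 1 ∧ |y - (s - t) * d'| < 1 := by
  obtain ⟨σ, hσ, hev⟩ := exists_near_pos hd hx
  have lim : ∀ f : ℝ → ℝ, Continuous f → Tendsto f (𝓝[>] 0) (𝓝 (f 0)) := fun f hf =>
    (hf.tendsto 0).mono_left nhdsWithin_le_nhds
  have h1 : ∀ᶠ η in 𝓝[>] (0 : ℝ), |y + η * (σ * d')| < 1 :=
    (lim (fun η => |y + η * (σ * d')|) (by fun_prop)).eventually_lt tendsto_const_nhds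
      (by simpa using hy)
  have h2 : ∀ᶠ η in 𝓝[>] (0 : ℝ), t - η * σ ∈ Ioo (0 : ℝ) 1 :=
    (lim (fun η => t - η * σ) (by fun_prop)).eventually
      (by simp only [zero_mul, sub_zero]; exact isOpen_Ioo.mem_nhds ht)
  obtain ⟨η, h0, h1, h2⟩ := (hev.and (h1.and h2)).exists
  refine ⟨t - η * σ, Ioo_subset_Icc_self h2, ?_, ?_⟩
  · convert h0 using 2; ring
  · convert h1 using 2; ring

/-- A contact at an end point, or at a side of the square parallel to the segment, puts `p` on an
axis-parallel line. Contact of an inner point with another side is excluded by sliding. Contact at a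
corner puts `p` on a translate of the line of the segment. -/
theorem mem_sideLines {e : Plane × Plane} {p q : Plane} (hq : q ∈ segment ℝ e.1 e.2)
    (hpq : supDist p q = 1) (hfar : ∀ x ∈ segment ℝ e.1 e.2, 1 ≤ supDist p x) :
    p ∈ ⋃₀ sideLines e := by
  obtain ⟨a, b⟩ := e
  have key : ∀ α β κ : ℝ, IsLine {p : Plane | α * p 0 + β * p 1 = κ} → α * p 0 + β * p 1 = κ →
      (⟨α, β, κ⟩ : ℝ × ℝ × ℝ) ∈ ({(1, 0, a 0 + 1), (1, 0, a 0 - 1), (0, 1, a 1 + 1),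
     (0, 1, a 1 - 1), (1, 0, b 0 + 1), (1, 0, b 0 - 1), (0, 1, b 1 + 1), (0, 1, b 1 - 1),
     (b 1 - a 1, a 0 - b 0, (b 1 - a 1) * (a 0 + 1) + (a 0 - b 0) * (a 1 + 1)),
     (b 1 - a 1, a 0 - b 0, (b 1 - a 1) * (a 0 + 1) + (a 0 - b 0) * (a 1 - 1)),
     (b 1 - a 1, a 0 - b 0, (b 1 - a 1) * (a 0 - 1) + (a 0 - b 0) * (a 1 + 1)),
     (b 1 - a 1, a 0 - b 0, (b 1 - a 1) * (a 0 - 1) + (a 0 - b 0) * (a 1 - 1))} :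
       Set (ℝ × ℝ × ℝ)) → p ∈ ⋃₀ sideLines (a, b) :=
    fun α β κ hL h hmem => ⟨_, ⟨mem_image_of_mem _ hmem, hL⟩, h⟩
  have key0 : ∀ κ : ℝ, p 0 = κ → κ = a 0 + 1 ∨ κ = a 0 - 1 ∨ κ = b 0 + 1 ∨ κ = b 0 - 1 →
      p ∈ ⋃₀ sideLines (a, b) := by
    intro κ h h'
    refine key 1 0 κ (isLine_eq_zero κ) (by linarith) ?_
    rcases h' with rfl | rfl | rfl | rfl <;> simp
  have key1 : ∀ κ : ℝ, p 1 = κ → κ = a 1 + 1 ∨ κ = a 1 - 1 ∨ κ = b 1 + 1 ∨ κ = b 1 - 1 →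
      p ∈ ⋃₀ sideLines (a, b) := by
    intro κ h h'
    refine key 0 1 κ (isLine_eq_one κ) (by linarith) ?_
    rcases h' with rfl | rfl | rfl | rfl <;> simp
  have hends : q = a ∨ q = b → p ∈ ⋃₀ sideLines (a, b) := by
    rintro (rfl | rfl) <;> rcases eq_add_or_sub_of_supDist_eq hpq with (h | h) | (h | h)
    all_goals first
      | exact key0 _ h (by simp)
      | exact key1 _ h (by simp)
  rw [segment_eq_image'] at hq hfar
  obtain ⟨t, ht, rfl⟩ := hq
  by_cases hta : t = 0
  · exact hends (Or.inl (by simp [hta]))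
  by_cases htb : t = 1
  · exact hends (Or.inr (by simp [htb]))
  by_cases hab : a = b
  · exact hends (Or.inl (by simp [hab]))
  have ht' : t ∈ Ioo (0 : ℝ) 1 := ⟨ht.1.lt_of_ne' hta, ht.2.lt_of_ne htb⟩
  have hfar' : ∀ s ∈ Icc (0 : ℝ) 1,
      ¬ (|p 0 - (a 0 + s * (b 0 - a 0))| < 1 ∧ |p 1 - (a 1 + s * (b 1 - a 1))| < 1) := by
    rintro s hs ⟨h0, h1⟩
    have := hfar _ ⟨s, hs, rfl⟩
    unfold supDist at this
    simp only [PiLp.add_apply, PiLp.smul_apply, PiLp.sub_apply, smul_eq_mul] at this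
    exact absurd (max_lt h0 h1) this.not_gt
  have hmax : max |p 0 - (a 0 + t * (b 0 - a 0))| |p 1 - (a 1 + t * (b 1 - a 1))| = 1 := by
    simpa [supDist] using hpq
  have hline : ∀ κ : ℝ, IsLine {p : Plane | (b 1 - a 1) * p 0 + (a 0 - b 0) * p 1 = κ} := by
    intro κ
    refine ⟨_, _, κ, ?_, rfl⟩
    by_contra! h
    exact hab (plane_ext (by linarith [h.2]) (by linarith [h.1]))
  have h0le := (le_max_left _ _).trans hmax.le
  have h1le := (le_max_right _ _).trans hmax.le
  rcases h0le.lt_or_eq with h0 | h0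
  · have h1 : |p 1 - (a 1 + t * (b 1 - a 1))| = 1 := by
      rcases max_choice |p 0 - (a 0 + t * (b 0 - a 0))| |p 1 - (a 1 + t * (b 1 - a 1))| with h | h
      · rw [hmax] at h; exact absurd h h0.ne'
      · rw [← h, hmax]
    by_cases hd : b 1 - a 1 = 0
    · rw [hd, mul_zero, add_zero] at h1
      rcases (abs_eq zero_le_one).1 h1 with h | h
      · exact key1 _ rfl (Or.inl (by linarith))
      · exact key1 _ rfl (Or.inr (Or.inl (by linarith)))
    · obtain ⟨s, hs, hs1, hs0⟩ := not_far_of_abs_eq (d' := b 0 - a 0) hd h1 h0 ht'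
      refine absurd ⟨?_, ?_⟩ (hfar' s hs)
      · convert hs0 using 2; ring
      · convert hs1 using 2; ring
  · rcases h1le.lt_or_eq with h1 | h1
    · by_cases hd : b 0 - a 0 = 0
      · rw [hd, mul_zero, add_zero] at h0
        rcases (abs_eq zero_le_one).1 h0 with h | h
        · exact key0 _ rfl (Or.inl (by linarith))
        · exact key0 _ rfl (Or.inr (Or.inl (by linarith)))
      · obtain ⟨s, hs, hs0, hs1⟩ := not_far_of_abs_eq (d' := b 1 - a 1) hd h0 h1 ht'
        refine absurd ⟨?_, ?_⟩ (hfar' s hs)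
        · convert hs0 using 2; ring
        · convert hs1 using 2; ring
    · rcases (abs_eq zero_le_one).1 h0 with h0 | h0 <;>
        rcases (abs_eq zero_le_one).1 h1 with h1 | h1
      · refine key _ _ ((b 1 - a 1) * (a 0 + 1) + (a 0 - b 0) * (a 1 + 1)) (hline _) ?_ (by simp)
        linear_combination (b 1 - a 1) * h0 + (a 0 - b 0) * h1
      · refine key _ _ ((b 1 - a 1) * (a 0 + 1) + (a 0 - b 0) * (a 1 - 1)) (hline _) ?_ (by simp)
        linear_combination (b 1 - a 1) * h0 + (a 0 - b 0) * h1
      · refine key _ _ ((b 1 - a 1) * (a 0 - 1) + (a 0 - b 0) * (a 1 + 1)) (hline _) ?_ (by simp)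
        linear_combination (b 1 - a 1) * h0 + (a 0 - b 0) * h1
      · refine key _ _ ((b 1 - a 1) * (a 0 - 1) + (a 0 - b 0) * (a 1 - 1)) (hline _) ?_ (by simp)
        linear_combination (b 1 - a 1) * h0 + (a 0 - b 0) * h1

/-- Finiteness is needed later to speak of the next vertex along a boundary curve. -/
theorem exists_finite_lines {P : Set Plane} (hP : IsPolygonalEnvironment P) :
    ∃ T : Set (Set Plane), T.Finite ∧ (∀ L ∈ T, IsLine L) ∧ frontier (freeSpace P 1) ⊆ ⋃₀ T := by
  obtain ⟨hcl, S, hS⟩ := hP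
  refine ⟨⋃ e ∈ S, sideLines e, S.finite_toSet.biUnion fun e _ => finite_sideLines e, ?_, ?_⟩
  · intro L hL
    simp only [mem_iUnion] at hL
    obtain ⟨e, -, hL⟩ := hL
    exact hL.2
  · intro p hp
    obtain ⟨hfar, q, hq, hpq⟩ := exists_mem_frontier_supDist_eq hcl one_pos hp
    rw [hS] at hq hfar
    simp only [mem_iUnion, exists_prop] at hq
    obtain ⟨e, he, hq⟩ := hq
    obtain ⟨L, hL, hpL⟩ := mem_sideLines hq hpq fun x hx =>
      hfar x (mem_iUnion₂.2 ⟨e, he, hx⟩)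
    exact ⟨L, mem_iUnion₂.2 ⟨e, he, hL⟩, hpL⟩

/-! ### Edges along a curve in the boundary -/

/-- The derivative is locally constant on the connected interval, hence constant; the end points
follow by continuity. -/
theorem affine_of_locally_affine {E : Type*} [NormedAddCommGroup E] [NormedSpace ℝ E]
    {γ : ℝ → E} {a b : ℝ} (hab : a < b) (hγ : Continuous γ)
    (h : ∀ u ∈ Ioo a b, ∃ w : E, ∀ᶠ u' in 𝓝 u, γ u' = γ u + (u' - u) • w) :
    ∃ w : E, ∀ u ∈ Icc a b, γ u = γ a + (u - a) • w := by
  have hder : ∀ (c : E) (w : E) (u x : ℝ),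
      HasDerivAt (fun u' : ℝ => c + (u' - u) • w) w x := by
    intro c w u x
    simpa using (((hasDerivAt_id x).sub_const u).smul_const w).const_add c
  have h1 : ∀ u ∈ Ioo a b, ∃ w : E, ∀ᶠ u' in 𝓝 u, HasDerivAt γ w u' := by
    intro u hu
    obtain ⟨w, hw⟩ := h u hu
    refine ⟨w, hw.eventually_nhds.mono fun u' hu' => ?_⟩
    exact (hder (γ u) w u u').congr_of_eventuallyEq hu'
  have h2 : ∀ u ∈ Ioo a b, HasDerivAt (deriv γ) 0 u := by
    intro u hu
    obtain ⟨w, hw⟩ := h1 u hu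
    exact (hasDerivAt_const u w).congr_of_eventuallyEq (hw.mono fun u' hu' => hu'.deriv)
  obtain ⟨w, hw⟩ : ∃ w, ∀ u ∈ Ioo a b, deriv γ u = w :=
    isOpen_Ioo.exists_is_const_of_deriv_eq_zero isPreconnected_Ioo
      (fun u hu => (h2 u hu).differentiableAt.differentiableWithinAt) fun u hu => (h2 u hu).deriv
  have h3 : ∀ u ∈ Ioo a b, HasDerivAt (fun u => γ u - u • w) 0 u := by
    intro u hu
    obtain ⟨w', hw'⟩ := h1 u hu
    have e : w' = w := hw'.self_of_nhds.deriv ▸ hw u hu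
    subst e
    have := hw'.self_of_nhds.sub ((hasDerivAt_id u).smul_const w')
    rw [one_smul, sub_self] at this
    exact this
  obtain ⟨c, hc⟩ : ∃ c, ∀ u ∈ Ioo a b, γ u - u • w = c :=
    isOpen_Ioo.exists_is_const_of_deriv_eq_zero isPreconnected_Ioo
      (fun u hu => (h3 u hu).differentiableAt.differentiableWithinAt) fun u hu => (h3 u hu).deriv
  have h4 : ∀ u ∈ Icc a b, γ u - u • w = c := by
    have : EqOn (fun u => γ u - u • w) (fun _ => c) (closure (Ioo a b)) :=
      EqOn.closure hc (by fun_prop) continuous_const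
    rwa [closure_Ioo hab.ne] at this
  refine ⟨w, fun u hu => ?_⟩
  have e1 := h4 u hu
  have e2 := h4 a (left_mem_Icc.2 hab.le)
  rw [sub_eq_iff_eq_add] at e1 e2
  rw [e1, e2, sub_smul]
  abel

/-- A curve that is a section of a linear form runs straight near a point that is not a vertex. -/
theorem locally_affine_of_not_mem_vertices {F : Set Plane} {γ : ℝ → Plane} (hγ : Continuous γ)
    (ζ : Plane →L[ℝ] ℝ) (hζ : ∀ u, ζ (γ u) = u) {u : ℝ}
    (hfr : ∀ᶠ u' in 𝓝 u, γ u' ∈ frontier F) (hu : γ u ∉ vertices F) :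
    ∃ w : Plane, ∀ᶠ u' in 𝓝 u, γ u' = γ u + (u' - u) • w := by
  have : ∃ d : Plane, d ≠ 0 ∧ ∀ᶠ x in 𝓝 (γ u), x ∈ frontier F ↔ ∃ l : ℝ, x = γ u + l • d := by
    by_contra hne
    exact hu ⟨hfr.self_of_nhds, hne⟩
  obtain ⟨d, -, hd⟩ := this
  have hev : ∀ᶠ u' in 𝓝 u, ∃ l : ℝ, γ u' = γ u + l • d := by
    filter_upwards [hfr, (hγ.tendsto u).eventually hd] with u' h1 h2 using h2.1 h1
  have hl : ∀ (u' l : ℝ), γ u' = γ u + l • d → u' - u = l * ζ d := by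
    intro u' l h
    have := congrArg ζ h
    rw [map_add, map_smul, hζ, hζ, smul_eq_mul] at this
    linarith
  refine ⟨(ζ d)⁻¹ • d, hev.mono fun u' ⟨l, h⟩ => ?_⟩
  -- If `ζ d = 0` then `u' = u`, and the formula with slope `0⁻¹ • d = 0` still holds.
  by_cases h0 : ζ d = 0
  · have := hl u' l h
    rw [h0, mul_zero, sub_eq_zero] at this
    simp [this]
  · rw [h, hl u' l h, smul_smul, mul_assoc, mul_inv_cancel₀ h0, mul_one]

/-- If only one line `L` passed through the point, the boundary would locally lie in `L`; the curve,
being a section of `ζ`, would cover `L` nearby, so the boundary would be straight there. -/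
theorem exists_ne_of_mem_vertices {F : Set Plane} {T : Set (Set Plane)} (hT : T.Finite)
    (hline : ∀ L ∈ T, IsLine L) (hsub : frontier F ⊆ ⋃₀ T) {γ : ℝ → Plane} (hγ : Continuous γ)
    (ζ : Plane →L[ℝ] ℝ) (hζ : ∀ u, ζ (γ u) = u) {u : ℝ}
    (hfr : ∀ᶠ u' in 𝓝 u, γ u' ∈ frontier F) (hu : γ u ∈ vertices F) :
    ∃ L ∈ T, ∃ M ∈ T, L ≠ M ∧ γ u ∈ L ∩ M := by
  obtain ⟨L, hL, huL⟩ := hsub hu.1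
  by_contra! hne
  refine hu.2 ?_
  have hloc : ∀ᶠ x in 𝓝 (γ u), x ∈ frontier F → x ∈ L := by
    have : ∀ᶠ x in 𝓝 (γ u), ∀ M ∈ T \ {L}, x ∉ M := by
      refine (eventually_all_finite (hT.subset sdiff_subset)).2 fun M hM => ?_
      refine (hline M hM.1).isClosed.isOpen_compl.mem_nhds fun h => ?_
      exact hne L hL M hM.1 (fun h => hM.2 h.symm) ⟨huL, h⟩
    filter_upwards [this] with x hx hxF
    obtain ⟨M, hM, hxM⟩ := hsub hxF
    by_cases e : M = L
    · exact e ▸ hxM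
    · exact absurd hxM (hx M ⟨hM, e⟩)
  have hγL : ∀ᶠ u' in 𝓝 u, γ u' ∈ L := by
    filter_upwards [hfr, (hγ.tendsto u).eventually hloc] with u' h1 h2 using h2 h1
  obtain ⟨u₁, hu₁L, hu₁⟩ : ∃ u₁, γ u₁ ∈ L ∧ u₁ ≠ u := by
    have : ∀ᶠ u' in 𝓝[≠] u, γ u' ∈ L ∧ u' ≠ u :=
      (hγL.filter_mono nhdsWithin_le_nhds).and self_mem_nhdsWithin
    exact this.exists
  have hne' : γ u ≠ γ u₁ := fun h => hu₁ (by rw [← hζ u₁, ← hζ u, h])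
  refine ⟨γ u₁ - γ u, sub_ne_zero.2 hne'.symm, ?_⟩
  have hζt : Tendsto ζ (𝓝 (γ u)) (𝓝 u) := by
    have := ζ.continuous.tendsto (γ u)
    rwa [hζ] at this
  filter_upwards [hloc, hζt.eventually hγL, hζt.eventually hfr] with x h1 h2 h3
  constructor
  · intro hx
    exact (hline L hL).subset huL hu₁L hne' (h1 hx)
  · rintro ⟨l, hl⟩
    obtain ⟨l', hl'⟩ := (hline L hL).subset huL hu₁L hne' h2
    have e1 := congrArg ζ hl
    have e2 := congrArg ζ hl'
    rw [map_add, map_smul, map_sub, hζ, hζ, smul_eq_mul] at e1 e2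
    rw [hζ] at e2
    have : l = l' := mul_right_cancel₀ (sub_ne_zero.2 hu₁) (by linarith)
    rw [hl, this, ← hl']
    exact h3

theorem exists_isEdge {F : Set Plane} {T : Set (Set Plane)} (hT : T.Finite)
    (hline : ∀ L ∈ T, IsLine L) (hsub : frontier F ⊆ ⋃₀ T) {γ : ℝ → Plane} (hγ : Continuous γ)
    (ζ : Plane →L[ℝ] ℝ) (hζ : ∀ u, ζ (γ u) = u) {a b : ℝ} (hab : a < b)
    (hfr : ∀ u ∈ Icc a b, γ u ∈ frontier F) (ha : γ a ∈ vertices F) (hb : γ b ∈ vertices F) :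
    ∃ b' ∈ Ioc a b, IsEdge F (γ a) (γ b') := by
  have hinj : Function.Injective γ := fun u v h => by rw [← hζ u, ← hζ v, h]
  have hfr' : ∀ u ∈ Ioo a b, ∀ᶠ u' in 𝓝 u, γ u' ∈ frontier F := fun u hu => by
    filter_upwards [isOpen_Ioo.mem_nhds hu] with u' hu' using hfr u' (Ioo_subset_Icc_self hu')
  -- Each vertex on the curve is the intersection of two distinct lines of the finite family, and
  -- `γ` is injective.
  have hfin : {u ∈ Ioo a b | γ u ∈ vertices F}.Finite := by
    refine (hT.biUnion fun L hL => hT.biUnion fun M hM =>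
      show (⋃ _ : L ≠ M, γ ⁻¹' (L ∩ M)).Finite from ?_).subset fun u hu => ?_
    · by_cases h : L = M
      · simp [h]
      · simp only [ne_eq, h, not_false_eq_true, iUnion_true]
        exact (((hline L hL).inter_subsingleton (hline M hM) h).preimage hinj).finite
    · obtain ⟨L, hL, M, hM, hne, h⟩ :=
        exists_ne_of_mem_vertices hT hline hsub hγ ζ hζ (hfr' u hu.1) hu.2
      simp only [mem_iUnion]
      exact ⟨L, hL, M, hM, hne, h⟩
  obtain ⟨b', hb', hmin⟩ := (hfin.insert b).exists_minimal (insert_nonempty _ _)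
  have hb'' : b' ∈ Ioc a b ∧ γ b' ∈ vertices F := by
    rcases hb' with rfl | h
    · exact ⟨⟨hab, le_rfl⟩, hb⟩
    · exact ⟨Ioo_subset_Ioc_self h.1, h.2⟩
  have hno : ∀ u ∈ Ioo a b', γ u ∉ vertices F := by
    intro u hu h
    have := hmin (mem_insert_of_mem b ⟨⟨hu.1, hu.2.trans_le hb''.1.2⟩, h⟩) hu.2.le
    exact this.not_gt hu.2
  obtain ⟨w, hw⟩ := affine_of_locally_affine hb''.1.1 hγ fun u hu =>
    locally_affine_of_not_mem_vertices hγ ζ hζ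
      (hfr' u ⟨hu.1, hu.2.trans_le hb''.1.2⟩) (hno u hu)
  refine ⟨b', hb''.1, fun h => hb''.1.1.ne (hinj h), ha, hb''.2, ?_⟩
  rw [openSegment_eq_image']
  rintro _ ⟨t, ht, rfl⟩
  have hlt : 0 < b' - a := sub_pos.2 hb''.1.1
  have hmem : a + t * (b' - a) ∈ Ioo a b' :=
    ⟨by nlinarith [ht.1], by nlinarith [ht.2]⟩
  have e : γ a + t • (γ b' - γ a) = γ (a + t * (b' - a)) := by
    rw [hw b' (right_mem_Icc.2 hb''.1.1.le), hw _ (Ioo_subset_Icc_self hmem)]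
    rw [add_sub_cancel_left, smul_smul, add_sub_cancel_left]
  simp only [e]
  exact ⟨hfr _ ⟨hmem.1.le, hmem.2.le.trans hb''.1.2⟩, hno _ hmem⟩

/-! ### Graphs of height functions -/

/-- The cone condition makes every vertical section a down-set and bounds how fast its supremum
varies; openness makes the supremum unattained. -/
theorem exists_height {S : Set (ℝ × ℝ)} (hS : IsOpen S) (hne : S.Nonempty) (hun : Sᶜ.Nonempty)
    (hcone : ∀ w ∈ S, ∀ w' : ℝ × ℝ, |w'.1 - w.1| ≤ w.2 - w'.2 → w' ∈ S) :
    ∃ h : ℝ → ℝ, (∀ u u', h u ≤ h u' + |u - u'|) ∧ ∀ u v, (u, v) ∈ S ↔ v < h u := by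
  obtain ⟨d, hd⟩ := hne
  obtain ⟨x, hx⟩ := hun
  have hbdd : ∀ u, BddAbove {v | (u, v) ∈ S} := fun u => by
    refine ⟨x.2 + |x.1 - u|, fun v hv => ?_⟩
    by_contra! hlt
    exact hx (hcone _ hv x (by dsimp only; linarith))
  have hne : ∀ u, {v | (u, v) ∈ S}.Nonempty := fun u =>
    ⟨d.2 - |u - d.1|, hcone d hd _ (by dsimp only; linarith)⟩
  have hiff : ∀ u v, (u, v) ∈ S ↔ v < sSup {v | (u, v) ∈ S} := by
    intro u v
    constructor
    · intro h
      have : ∀ᶠ v' in 𝓝[>] v, (u, v') ∈ S :=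
        ((by fun_prop : Continuous fun v' : ℝ => (u, v')).tendsto v).eventually (hS.mem_nhds h)
          |>.filter_mono nhdsWithin_le_nhds
      obtain ⟨v', h1, h2⟩ := (this.and self_mem_nhdsWithin).exists
      exact lt_of_lt_of_le h2 (le_csSup (hbdd u) h1)
    · intro h
      obtain ⟨v', h1, h2⟩ := exists_lt_of_lt_csSup (hne u) h
      exact hcone _ h1 _ (by simpa using h2.le)
  refine ⟨fun u => sSup {v | (u, v) ∈ S}, fun u u' => ?_, hiff⟩
  refine csSup_le (hne u) fun v hv => ?_
  have : (u', v - |u - u'|) ∈ S := hcone _ hv _ (by dsimp only; rw [abs_sub_comm]; linarith)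
  linarith [(hiff _ _).1 this]

/-- If a chord over the graph of a function dips below the graph, then the graph has a bend above
the chord. -/
theorem exists_bend {h : ℝ → ℝ} (hLip : ∀ u u', h u ≤ h u' + |u - u'|) {a b m v u₀ : ℝ}
    (hab : a < b) (ha : h a ≤ v) (hb : h b ≤ v + (b - a) * m) (hu₀ : u₀ ∈ Icc a b)
    (hdip : v + (u₀ - a) * m < h u₀) :
    |m| ≤ 1 ∧ ∃ u ∈ Ioo a b, v + (u - a) * m < h u ∧
      ¬ ∃ m' : ℝ, ∀ᶠ u' in 𝓝 u, h u' = h u + (u' - u) * m' := by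
  have hcont : Continuous h := by
    refine (LipschitzWith.of_le_add fun u u' => ?_ : LipschitzWith 1 h).continuous
    exact hLip u u'
  constructor
  · rw [abs_le]
    constructor
    · by_contra! hm
      have := hLip u₀ b
      rw [abs_of_nonpos (by linarith [hu₀.2])] at this
      nlinarith [hu₀.2]
    · by_contra! hm
      have := hLip u₀ a
      rw [abs_of_nonneg (by linarith [hu₀.1])] at this
      nlinarith [hu₀.1]
  set φ : ℝ → ℝ := fun u => h u - (v + (u - a) * m) with hφ
  have hφc : Continuous φ := by fun_prop
  obtain ⟨M, hM, hmax⟩ := isCompact_Icc.exists_isMaxOn (nonempty_Icc.2 hab.le) hφc.continuousOn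
  have hcomp : IsCompact (Icc a b ∩ φ ⁻¹' {φ M}) :=
    isCompact_Icc.inter_right (isClosed_singleton.preimage hφc)
  -- The rightmost maximizer of the height over the chord is the bend: if `h` were affine there,
  -- maximality would force the slope `m`, and there would be maximizers further right.
  obtain ⟨u, ⟨hu, huM⟩, hgr⟩ := hcomp.exists_isGreatest ⟨M, hM, rfl⟩
  have huM : φ u = φ M := huM
  have hpos : 0 < φ u := by
    rw [huM]
    have h1 : φ u₀ ≤ φ M := hmax hu₀
    have h2 : 0 < φ u₀ := by simp only [hφ]; linarith
    linarith
  have hua : u ≠ a := by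
    rintro rfl
    simp only [hφ, sub_self, zero_mul] at hpos
    linarith
  have hub : u ≠ b := by
    rintro rfl
    simp only [hφ] at hpos
    linarith
  have hu' : u ∈ Ioo a b := ⟨hu.1.lt_of_ne' hua, hu.2.lt_of_ne hub⟩
  refine ⟨u, hu', by simp only [hφ] at hpos; linarith, ?_⟩
  rintro ⟨m', hm'⟩
  have hle : ∀ᶠ u' in 𝓝 u, (u' - u) * (m' - m) ≤ 0 ∧ (u < u' → (u' - u) * (m' - m) ≠ 0) := by
    filter_upwards [hm', isOpen_Ioo.mem_nhds hu'] with u' h1 h2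
    have h3 : φ u' = φ u + (u' - u) * (m' - m) := by
      simp only [hφ]
      rw [h1]
      ring
    have h4 : φ u' ≤ φ M := hmax (Ioo_subset_Icc_self h2)
    refine ⟨by linarith, fun hlt h0 => ?_⟩
    exact hlt.not_ge (hgr ⟨Ioo_subset_Icc_self h2, by
      rw [mem_preimage, mem_singleton_iff, h3, h0, add_zero, huM]⟩)
  obtain ⟨l, hl, hlu⟩ := (((hle.filter_mono nhdsWithin_le_nhds : ∀ᶠ u' in 𝓝[<] u, _)).and
    self_mem_nhdsWithin).exists
  obtain ⟨r, hr, hru⟩ := (((hle.filter_mono nhdsWithin_le_nhds : ∀ᶠ u' in 𝓝[>] u, _)).and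
    self_mem_nhdsWithin).exists
  have hlu : l < u := hlu
  have hru : u < r := hru
  have h1 : m' - m ≤ 0 := by nlinarith [hr.1]
  have h2 : 0 ≤ m' - m := by nlinarith [hl.1]
  exact hr.2 hru (by rw [le_antisymm h1 h2, mul_zero])

/-! ### Diagonal coordinates -/

/-- The point with `a * x + b * y = v` and `a * x - b * y = u`, for signs `a` and `b`. -/
noncomputable def diagPoint (a b u v : ℝ) : Plane := !₂[a * ((v + u) / 2), b * ((v - u) / 2)]

/-- The first diagonal coordinate. -/
noncomputable def diagForm (a b : ℝ) : Plane →L[ℝ] ℝ :=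
  a • EuclideanSpace.proj (0 : Fin 2) - b • EuclideanSpace.proj (1 : Fin 2)

theorem diagForm_apply (a b : ℝ) (p : Plane) : diagForm a b p = a * p 0 - b * p 1 := by
  simp [diagForm]

theorem diagPoint_zero {a : ℝ} (ha : a * a = 1) (b u v : ℝ) :
    a * diagPoint a b u v 0 = (v + u) / 2 := by
  simp [diagPoint, ← mul_assoc, ha]

theorem diagPoint_one (a : ℝ) {b : ℝ} (hb : b * b = 1) (u v : ℝ) :
    b * diagPoint a b u v 1 = (v - u) / 2 := by
  simp [diagPoint, ← mul_assoc, hb]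

theorem diagPoint_diagForm {a b : ℝ} (ha : a * a = 1) (hb : b * b = 1) (p : Plane) :
    diagPoint a b (diagForm a b p) (a * p 0 + b * p 1) = p := by
  refine plane_ext ?_ ?_
  · have := diagPoint_zero ha b (diagForm a b p) (a * p 0 + b * p 1)
    rw [diagForm_apply] at *
    linear_combination a * this + (p 0 - diagPoint a b (a * p 0 - b * p 1) (a * p 0 + b * p 1) 0) * ha
  · have := diagPoint_one a hb (diagForm a b p) (a * p 0 + b * p 1)
    rw [diagForm_apply] at *
    linear_combination b * this + (p 1 - diagPoint a b (a * p 0 - b * p 1) (a * p 0 + b * p 1) 1) * hb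

theorem diagForm_diagPoint {a b : ℝ} (ha : a * a = 1) (hb : b * b = 1) (u v : ℝ) :
    diagForm a b (diagPoint a b u v) = u := by
  rw [diagForm_apply, diagPoint_zero ha, diagPoint_one a hb]
  ring

theorem continuous_diagPoint (a b : ℝ) :
    Continuous fun w : ℝ × ℝ => diagPoint a b w.1 w.2 := by
  unfold diagPoint
  fun_prop

theorem abs_sign_mul_sub {a : ℝ} (ha : a * a = 1) (x y : ℝ) : |a * x - a * y| = |x - y| := by
  have : |a| = 1 := by
    rcases mul_self_eq_one_iff.1 ha with rfl | rfl <;> simp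
  rw [← mul_sub, abs_mul, this, one_mul]

theorem supDist_le_iff_sign {a b : ℝ} (ha : a * a = 1) (hb : b * b = 1) {p q : Plane} {r : ℝ} :
    supDist p q ≤ r ↔ (a * p 0 ≤ a * q 0 + r ∧ a * q 0 ≤ a * p 0 + r) ∧
      (b * p 1 ≤ b * q 1 + r ∧ b * q 1 ≤ b * p 1 + r) := by
  rw [supDist_le_iff, ← abs_sign_mul_sub ha (p 0), ← abs_sign_mul_sub hb (p 1), abs_le, abs_le]
  constructor
  · rintro ⟨⟨h1, h2⟩, h3, h4⟩
    refine ⟨⟨?_, ?_⟩, ?_, ?_⟩ <;> linarith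
  · rintro ⟨⟨h1, h2⟩, h3, h4⟩
    refine ⟨⟨?_, ?_⟩, ?_, ?_⟩ <;> linarith

/-! ### The obstacles seen from one corner -/

/-- The union of the quadrants which, near `o`, the forbidden squares with a center at the
`(-a, -b)`-side of `o` cover. -/
def blocked (P : Set Plane) (a b : ℝ) (o : Plane) : Set Plane :=
  {p | ∃ q ∉ P, a * q 0 < a * o 0 + 1 / 2 ∧ b * q 1 < b * o 1 + 1 / 2 ∧
    a * p 0 ≤ a * q 0 + 1 ∧ b * p 1 ≤ b * q 1 + 1}

theorem blocked_lower {P : Set Plane} {a b : ℝ} {o p p' : Plane} (hp : p ∈ blocked P a b o)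
    (h0 : a * p' 0 ≤ a * p 0) (h1 : b * p' 1 ≤ b * p 1) : p' ∈ blocked P a b o := by
  obtain ⟨q, hq, hq0, hq1, hp0, hp1⟩ := hp
  exact ⟨q, hq, hq0, hq1, h0.trans hp0, h1.trans hp1⟩

theorem isOpen_blocked {P : Set Plane} (hP : IsClosed P) {a b : ℝ} (ha : a * a = 1)
    (hb : b * b = 1) (o : Plane) : IsOpen (blocked P a b o) := by
  rw [isOpen_iff_mem_nhds]
  rintro p ⟨q, hq, hq0, hq1, hp0, hp1⟩
  -- The obstacle point can be pushed outward a little, so its quadrant contains a neighbourhood of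
  -- `p`.
  have : ∀ᶠ η in 𝓝[>] (0 : ℝ), (!₂[q 0 + a * η, q 1 + b * η] : Plane) ∉ P ∧
      a * q 0 + η < a * o 0 + 1 / 2 ∧ b * q 1 + η < b * o 1 + 1 / 2 := by
    refine Eventually.filter_mono nhdsWithin_le_nhds ?_
    have hc : Continuous fun η : ℝ => (!₂[q 0 + a * η, q 1 + b * η] : Plane) := by fun_prop
    have h1 : (!₂[q 0 + a * 0, q 1 + b * 0] : Plane) = q := plane_ext (by simp) (by simp)
    refine Eventually.and ?_ (Eventually.and ?_ ?_)
    · exact (hc.tendsto 0).eventually (hP.isOpen_compl.mem_nhds (by rw [h1]; exact hq))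
    · exact ((by fun_prop : Continuous fun η : ℝ => a * q 0 + η).tendsto 0).eventually_lt
        tendsto_const_nhds (by simpa using hq0)
    · exact ((by fun_prop : Continuous fun η : ℝ => b * q 1 + η).tendsto 0).eventually_lt
        tendsto_const_nhds (by simpa using hq1)
  obtain ⟨η, ⟨h1, h2, h3⟩, hη⟩ := (this.and self_mem_nhdsWithin).exists
  have hη : 0 < η := hη
  have e0 : a * (!₂[q 0 + a * η, q 1 + b * η] : Plane) 0 = a * q 0 + η := by
    simp; linear_combination η * ha
  have e1 : b * (!₂[q 0 + a * η, q 1 + b * η] : Plane) 1 = b * q 1 + η := by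
    simp; linear_combination η * hb
  have c0 : ∀ᶠ x : Plane in 𝓝 p, a * x 0 < a * q 0 + η + 1 :=
    ((by fun_prop : Continuous fun x : Plane => a * x 0).tendsto p).eventually_lt
      tendsto_const_nhds (by linarith)
  have c1 : ∀ᶠ x : Plane in 𝓝 p, b * x 1 < b * q 1 + η + 1 :=
    ((by fun_prop : Continuous fun x : Plane => b * x 1).tendsto p).eventually_lt
      tendsto_const_nhds (by linarith)
  filter_upwards [c0, c1] with x h4 h5
  exact ⟨_, h1, by rw [e0]; exact h2, by rw [e1]; exact h3, by rw [e0]; exact h4.le,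
    by rw [e1]; exact h5.le⟩

/-- Within `1 / 2` of `o` the far sides of the square around `q` are out of reach, so the quadrant
and the forbidden square agree. -/
theorem notMem_freeSpace_of_mem_blocked {P : Set Plane} {a b : ℝ} (ha : a * a = 1)
    (hb : b * b = 1) {o p : Plane} (hp : p ∈ blocked P a b o) (hpo : supDist p o ≤ 1 / 2) :
    p ∉ freeSpace P 1 := by
  obtain ⟨q, hq, hq0, hq1, hp0, hp1⟩ := hp
  rw [supDist_le_iff_sign ha hb] at hpo
  intro h
  refine hq (h q ((supDist_le_iff_sign ha hb).2 ⟨⟨?_, ?_⟩, ?_, ?_⟩)) <;> linarith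

theorem exists_mem_blocked {P : Set Plane} {o p : Plane} (hp : p ∉ freeSpace P 1) :
    ∃ a b : Bool, p ∈ blocked P (cond a 1 (-1)) (cond b 1 (-1)) o := by
  simp only [freeSpace, mem_ofPred_eq, not_forall] at hp
  obtain ⟨q, hq, hqP⟩ := hp
  obtain ⟨h0, h1⟩ := supDist_le_iff.1 hq
  rw [abs_le] at h0 h1
  refine ⟨decide (q 0 < o 0), decide (q 1 < o 1), q, hqP, ?_⟩
  by_cases e0 : q 0 < o 0 <;> by_cases e1 : q 1 < o 1 <;>
    simp only [e0, e1, decide_true, decide_false, cond_true, cond_false] <;>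
    refine ⟨?_, ?_, ?_, ?_⟩ <;> linarith

/-- In a connected part of the free space, the boundary of the blocked region between two points
belongs to the boundary of the free space. -/
theorem mem_frontier_of_between {P : Set Plane} (hP : IsClosed P) {a b : ℝ} (ha : a * a = 1)
    (hb : b * b = 1) {o : Plane} {δ : ℝ} (hδ : δ < 1 / 2) {K : Set Plane} (hK : IsPreconnected K)
    (hKF : ∀ x ∈ K, x ∈ freeSpace P 1 ∧ supDist x o ≤ δ) {x y z : Plane} (hx : x ∈ K) (hy : y ∈ K)
    (hz : z ∉ blocked P a b o)
    (hz' : ∀ η > 0, ∃ d ∈ blocked P a b o, a * d 0 = a * z 0 - η ∧ b * d 1 = b * z 1 - η)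
    (hx0 : a * x 0 ≤ a * z 0) (hx1 : b * z 1 ≤ b * x 1) (hy0 : a * z 0 ≤ a * y 0)
    (hy1 : b * y 1 ≤ b * z 1) : z ∈ frontier (freeSpace P 1) := by
  have hxo := (supDist_le_iff_sign ha hb).1 (hKF x hx).2
  have hyo := (supDist_le_iff_sign ha hb).1 (hKF y hy).2
  rw [frontier_eq_closure_inter_closure]
  constructor
  · refine subset_closure fun q hq => ?_
    by_contra hqP
    have hq' := (supDist_le_iff_sign ha hb).1 hq
    -- An obstacle point `q` in the square around `z` would block `z` itself, or lie in the free
    -- square of `x` or of `y`, or lie beyond `o` in both coordinates. In the last case `K` would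
    -- have to squeeze between two opposite obstacles.
    rcases lt_or_ge (a * q 0) (a * o 0 + 1 / 2) with h0 | h0 <;>
      rcases lt_or_ge (b * q 1) (b * o 1 + 1 / 2) with h1 | h1
    · exact hz ⟨q, hqP, h0, h1, by linarith, by linarith⟩
    · refine hqP ((hKF x hx).1 q ((supDist_le_iff_sign ha hb).2 ⟨⟨?_, ?_⟩, ?_, ?_⟩)) <;> linarith
    · refine hqP ((hKF y hy).1 q ((supDist_le_iff_sign ha hb).2 ⟨⟨?_, ?_⟩, ?_, ?_⟩)) <;> linarith
    · have : ∀ᶠ η in 𝓝[>] (0 : ℝ), (!₂[q 0 - a * η, q 1 - b * η] : Plane) ∉ P := by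
        refine Eventually.filter_mono nhdsWithin_le_nhds ?_
        have hc : Continuous fun η : ℝ => (!₂[q 0 - a * η, q 1 - b * η] : Plane) := by fun_prop
        have h1 : (!₂[q 0 - a * 0, q 1 - b * 0] : Plane) = q := plane_ext (by simp) (by simp)
        exact (hc.tendsto 0).eventually (hP.isOpen_compl.mem_nhds (by rw [h1]; exact hqP))
      obtain ⟨η, ⟨hηP, hη2⟩, hη⟩ := ((this.and (Eventually.filter_mono nhdsWithin_le_nhds
        (Iio_mem_nhds (by linarith : (0 : ℝ) < 1 / 2 - δ)))).and self_mem_nhdsWithin).exists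
      have hη : 0 < η := hη
      have hη2 : η < 1 / 2 - δ := hη2
      have e0 : a * (!₂[q 0 - a * η, q 1 - b * η] : Plane) 0 = a * q 0 - η := by
        simp; linear_combination -η * ha
      have e1 : b * (!₂[q 0 - a * η, q 1 - b * η] : Plane) 1 = b * q 1 - η := by
        simp; linear_combination -η * hb
      obtain ⟨d, hd, hd0, hd1⟩ := hz' (η / 2) (by linarith)
      have hN : ∀ p ∈ K, a * p 0 < a * q 0 - η - 1 ∨ b * p 1 < b * q 1 - η - 1 := by
        intro p hp
        by_contra! h
        have hpo := (supDist_le_iff_sign ha hb).1 (hKF p hp).2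
        refine hηP ((hKF p hp).1 _ ((supDist_le_iff_sign ha hb).2 ?_))
        rw [e0, e1]
        refine ⟨⟨?_, ?_⟩, ?_, ?_⟩ <;> linarith [h.1, h.2]
      have hS : ∀ p ∈ K, a * d 0 < a * p 0 ∨ b * d 1 < b * p 1 := by
        intro p hp
        by_contra! h
        exact notMem_freeSpace_of_mem_blocked ha hb (blocked_lower hd h.1 h.2)
          ((hKF p hp).2.trans hδ.le) (hKF p hp).1
      -- Two open half-planes cover `K`, one containing `x` and the other `y`. By connectedness some
      -- point of `K` is in both, hence below `z` by more than `η` in both coordinates, inside the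
      -- quadrant of `d`.
      obtain ⟨p, hp, hp0, hp1⟩ := hK {p | a * p 0 < a * q 0 - η - 1} {p | b * p 1 < b * q 1 - η - 1}
        (isOpen_lt (by fun_prop) continuous_const) (isOpen_lt (by fun_prop) continuous_const)
        (fun p hp => hN p hp)
        ⟨x, hx, (hN x hx).resolve_right (by linarith)⟩
        ⟨y, hy, (hN y hy).resolve_left (by linarith)⟩
      simp only [mem_ofPred_eq] at hp0 hp1
      rcases hS p hp with h | h <;> linarith
  · rw [Metric.mem_closure_iff]
    intro ε hε
    set η := min (ε / 4) (1 / 2 - δ) with hη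
    have hη0 : 0 < η := lt_min (by linarith) (by linarith)
    have hη1 : η ≤ ε / 4 := min_le_left _ _
    have hη2 : η ≤ 1 / 2 - δ := min_le_right _ _
    obtain ⟨d, hd, hd0, hd1⟩ := hz' η hη0
    refine ⟨d, ?_, ?_⟩
    · refine notMem_freeSpace_of_mem_blocked ha hb hd ((supDist_le_iff_sign ha hb).2
        ⟨⟨?_, ?_⟩, ?_, ?_⟩) <;> linarith
    · have : supDist z d ≤ η := (supDist_le_iff_sign ha hb).2
        ⟨⟨by linarith, by linarith⟩, by linarith, by linarith⟩
      exact (dist_lt_of_supDist_le hη0 this).trans_le (by linarith)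

/-- Two points of a small connected part of the free space on the same side of a suitable diagonal
line are not separated by obstacles of a given orientation. -/
theorem exists_separator {P : Set Plane} (hP : IsPolygonalEnvironment P) {δ : ℝ} (hδ0 : 0 < δ)
    (hδ : δ < 1 / 2) (hedge : ∀ x y, IsEdge (freeSpace P 1) x y → 4 * δ ≤ dist x y)
    {a b : ℝ} (ha : a * a = 1) (hb : b * b = 1) {o : Plane} {K : Set Plane}
    (hK : IsPreconnected K) (hKF : ∀ x ∈ K, x ∈ freeSpace P 1 ∧ supDist x o ≤ δ) :
    ∃ w : ℝ, ∀ x ∈ K, ∀ y ∈ K, (diagForm a b x < w ↔ diagForm a b y < w) →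
      ∀ z ∈ segment ℝ x y, z ∉ blocked P a b o := by
  rcases K.eq_empty_or_nonempty with rfl | ⟨x₀, hx₀⟩
  · exact ⟨0, by simp⟩
  rcases (blocked P a b o).eq_empty_or_nonempty with hD | ⟨d₀, hd₀⟩
  · exact ⟨0, by simp [hD]⟩
  obtain ⟨T, hT, hline, hsub⟩ := exists_finite_lines hP
  have hKD : ∀ x ∈ K, x ∉ blocked P a b o := fun x hx h =>
    notMem_freeSpace_of_mem_blocked ha hb h ((hKF x hx).2.trans hδ.le) (hKF x hx).1
  obtain ⟨h, hLip, hh⟩ := exists_height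
    (S := (fun w : ℝ × ℝ => diagPoint a b w.1 w.2) ⁻¹' blocked P a b o)
    ((isOpen_blocked hP.1 ha hb o).preimage (continuous_diagPoint a b))
    ⟨(diagForm a b d₀, a * d₀ 0 + b * d₀ 1), by
      rw [mem_preimage, diagPoint_diagForm ha hb]; exact hd₀⟩
    ⟨(diagForm a b x₀, a * x₀ 0 + b * x₀ 1), by
      rw [mem_compl_iff, mem_preimage, diagPoint_diagForm ha hb]; exact hKD x₀ hx₀⟩
    (by
      rintro ⟨u, v⟩ hw ⟨u', v'⟩ hle
      rw [abs_le] at hle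
      refine blocked_lower hw ?_ ?_
      · rw [diagPoint_zero ha, diagPoint_zero ha]
        simp only at hle ⊢
        linarith [hle.1, hle.2]
      · rw [diagPoint_one a hb, diagPoint_one a hb]
        simp only at hle ⊢
        linarith [hle.1, hle.2])
  have hD : ∀ p : Plane, p ∈ blocked P a b o ↔ a * p 0 + b * p 1 < h (diagForm a b p) := fun p => by
    rw [← hh, mem_preimage, diagPoint_diagForm ha hb]
  have hcont : Continuous h :=
    (LipschitzWith.of_le_add fun u u' => hLip u u' : LipschitzWith 1 h).continuous
  set γ : ℝ → Plane := fun u => diagPoint a b u (h u) with hγ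
  have hγc : Continuous γ := (continuous_diagPoint a b).comp (continuous_id.prodMk hcont)
  have hγ0 : ∀ u, a * γ u 0 = (h u + u) / 2 := fun u => diagPoint_zero ha b u (h u)
  have hγ1 : ∀ u, b * γ u 1 = (h u - u) / 2 := fun u => diagPoint_one a hb u (h u)
  have hζ : ∀ u, diagForm a b (γ u) = u := fun u => diagForm_diagPoint ha hb u (h u)
  have hmono : ∀ u u', u ≤ u' → a * γ u 0 ≤ a * γ u' 0 ∧ b * γ u' 1 ≤ b * γ u 1 := by
    intro u u' hle
    have h1 := hLip u u'
    have h2 := hLip u' u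
    rw [abs_of_nonpos (by linarith)] at h1
    rw [abs_of_nonneg (by linarith)] at h2
    rw [hγ0, hγ0, hγ1, hγ1]
    constructor <;> linarith
  -- the relative position of a bend and two points between which it lies
  let Bet (x y : Plane) (u : ℝ) : Prop := x ∈ K ∧ y ∈ K ∧ a * x 0 ≤ a * γ u 0 ∧
    b * γ u 1 ≤ b * x 1 ∧ a * γ u 0 ≤ a * y 0 ∧ b * y 1 ≤ b * γ u 1
  have hfront : ∀ x y u, Bet x y u → γ u ∈ frontier (freeSpace P 1) := by
    rintro x y u ⟨hx, hy, h1, h2, h3, h4⟩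
    refine mem_frontier_of_between hP.1 ha hb hδ hK hKF hx hy ?_ ?_ h1 h2 h3 h4
    · rw [hD, hζ, hγ0, hγ1]
      linarith
    · intro η hη
      refine ⟨diagPoint a b u (h u - 2 * η), ?_, ?_, ?_⟩
      · rw [← mem_preimage (f := fun w : ℝ × ℝ => diagPoint a b w.1 w.2) (a := (u, h u - 2 * η)),
          hh]
        linarith
      · rw [diagPoint_zero ha, hγ0]; ring
      · rw [diagPoint_one a hb, hγ1]; ring
  -- A chord that enters the blocked region lies under a bend. The slope bound puts the graph above
  -- the chord between `x` and `y`, so it belongs to the boundary of the free space, where only a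
  -- vertex can bend.
  have hbad : ∀ x ∈ K, ∀ y ∈ K, diagForm a b x < diagForm a b y →
      ∀ z ∈ segment ℝ x y, z ∈ blocked P a b o → ∃ u, diagForm a b x < u ∧ u < diagForm a b y ∧
        Bet x y u ∧ γ u ∈ vertices (freeSpace P 1) := by
    intro x hx y hy hlt z hz hzD
    have hx' := mt (hD x).2 (hKD x hx)
    have hy' := mt (hD y).2 (hKD y hy)
    rw [not_lt] at hx' hy'
    rw [segment_eq_image'] at hz
    obtain ⟨t, ht, rfl⟩ := hz
    rw [hD, map_add, map_smul, map_sub] at hzD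
    simp only [PiLp.add_apply, PiLp.smul_apply, PiLp.sub_apply, smul_eq_mul] at hzD
    have hxc : a * x 0 - b * x 1 = diagForm a b x := (diagForm_apply a b x).symm
    have hyc : a * y 0 - b * y 1 = diagForm a b y := (diagForm_apply a b y).symm
    set ux := diagForm a b x
    set uy := diagForm a b y
    have hpos : 0 < uy - ux := sub_pos.2 hlt
    set m := ((a * y 0 + b * y 1) - (a * x 0 + b * x 1)) / (uy - ux) with hm
    have hm' : (uy - ux) * m = (a * y 0 + b * y 1) - (a * x 0 + b * x 1) := by
      rw [hm]; field_simp
    obtain ⟨habs, u, hu, hlow, hbend⟩ := exists_bend hLip (m := m) (u₀ := ux + t * (uy - ux)) hlt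
      hx' (by linarith) ⟨by nlinarith [ht.1], by nlinarith [ht.2]⟩ (by
        have : (ux + t * (uy - ux) - ux) * m = t * ((uy - ux) * m) := by ring
        rw [this, hm']
        linarith)
    rw [abs_le] at habs
    have hBet : ∀ u ∈ Ioo ux uy, a * x 0 + b * x 1 + (u - ux) * m < h u → Bet x y u := by
      intro u hu hlow
      have l1 := hLip u ux
      have l2 := hLip u uy
      rw [abs_of_pos (sub_pos.2 hu.1)] at l1
      rw [abs_of_neg (sub_neg.2 hu.2)] at l2
      refine ⟨hx, hy, ?_, ?_, ?_, ?_⟩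
      · rw [hγ0]
        nlinarith [hu.1]
      · rw [hγ1]
        linarith
      · rw [hγ0]
        linarith
      · rw [hγ1]
        nlinarith [hu.2]
    refine ⟨u, hu.1, hu.2, hBet u hu hlow, ?_⟩
    by_contra hv
    have hlow' : ∀ᶠ u' in 𝓝 u, a * x 0 + b * x 1 + (u' - ux) * m < h u' :=
      ((by fun_prop : Continuous fun u' : ℝ => a * x 0 + b * x 1 + (u' - ux) * m).tendsto
        u).eventually_lt (hcont.tendsto u) hlow
    obtain ⟨w, hw⟩ := locally_affine_of_not_mem_vertices hγc (diagForm a b) hζ (by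
      filter_upwards [isOpen_Ioo.mem_nhds hu, hlow'] with u' h1 h2
        using hfront x y u' (hBet u' h1 h2)) hv
    refine hbend ⟨a * w 0 + b * w 1, hw.mono fun u' hu' => ?_⟩
    have e0 := hγ0 u'
    have e1 := hγ1 u'
    rw [hu'] at e0 e1
    simp only [PiLp.add_apply, PiLp.smul_apply, smul_eq_mul] at e0 e1
    linear_combination hγ0 u + hγ1 u - e0 - e1
  -- Between two such vertices the whole graph lies between `x` and `y'`, so it is boundary and
  -- contains an edge. Its ends are within `2 * δ` in the maximum norm, too close for `hedge`.
  have huniq : ∀ x y u x' y' u', Bet x y u → γ u ∈ vertices (freeSpace P 1) → Bet x' y' u' →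
      γ u' ∈ vertices (freeSpace P 1) → ¬ u < u' := by
    rintro x y u x' y' u' ⟨hx, -, h1, h2, -, -⟩ hv ⟨-, hy', -, -, h3, h4⟩ hv' hlt
    have hBet : ∀ t ∈ Icc u u', Bet x y' t := fun t ht =>
      ⟨hx, hy', h1.trans (hmono u t ht.1).1, (hmono u t ht.1).2.trans h2,
        (hmono t u' ht.2).1.trans h3, h4.trans (hmono t u' ht.2).2⟩
    obtain ⟨b', hb', he⟩ := exists_isEdge hT hline hsub hγc (diagForm a b) hζ hlt
      (fun t ht => hfront _ _ _ (hBet t ht)) hv hv'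
    obtain ⟨-, -, k1, k2, k3, k4⟩ := hBet u (left_mem_Icc.2 hlt.le)
    obtain ⟨-, -, k1', k2', k3', k4'⟩ := hBet b' (Ioc_subset_Icc_self hb')
    have hxo := (supDist_le_iff_sign ha hb).1 (hKF x hx).2
    have hyo := (supDist_le_iff_sign ha hb).1 (hKF y' hy').2
    have : supDist (γ u) (γ b') ≤ 2 * δ := (supDist_le_iff_sign ha hb).2
      ⟨⟨by linarith, by linarith⟩, by linarith, by linarith⟩
    have := dist_lt_of_supDist_le (by linarith) this
    linarith [hedge _ _ he]
  obtain ⟨w, key⟩ : ∃ w : ℝ, ∀ x ∈ K, ∀ y ∈ K, diagForm a b x < diagForm a b y →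
      (diagForm a b x < w ↔ diagForm a b y < w) →
      ∀ z ∈ segment ℝ x y, z ∉ blocked P a b o := by
    by_cases hex : ∃ x y u, Bet x y u ∧ γ u ∈ vertices (freeSpace P 1)
    · obtain ⟨x₁, y₁, w, hBw, hvw⟩ := hex
      refine ⟨w, fun x hx y hy hlt hiff z hz hzD => ?_⟩
      obtain ⟨u, h1, h2, h3, h4⟩ := hbad x hx y hy hlt z hz hzD
      have e : u = w := le_antisymm (not_lt.1 (huniq _ _ _ _ _ _ hBw hvw h3 h4))
        (not_lt.1 (huniq _ _ _ _ _ _ h3 h4 hBw hvw))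
      exact absurd (hiff.1 (e ▸ h1)) (e ▸ h2).not_gt
    · refine ⟨0, fun x hx y hy hlt _ z hz hzD => ?_⟩
      obtain ⟨u, -, -, h3, h4⟩ := hbad x hx y hy hlt z hz hzD
      exact hex ⟨_, _, _, h3, h4⟩
  refine ⟨w, fun x hx y hy hiff z hz => ?_⟩
  rcases lt_trichotomy (diagForm a b x) (diagForm a b y) with hlt | heq | hlt
  · exact key x hx y hy hlt hiff z hz
  -- On a common vertical line of the diagonal coordinates, everything between two points above the
  -- graph is above it.
  · have hx' := mt (hD x).2 (hKD x hx)
    have hy' := mt (hD y).2 (hKD y hy)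
    obtain ⟨s, t, hs, ht, hst, rfl⟩ := hz
    rw [not_lt] at hx' hy'
    rw [hD, map_add, map_smul, map_smul, ← heq, ← add_smul, hst, one_smul, not_lt]
    rw [← heq] at hy'
    simp only [PiLp.add_apply, PiLp.smul_apply, smul_eq_mul]
    have h1 := mul_le_mul_of_nonneg_left hx' hs
    have h2 := mul_le_mul_of_nonneg_left hy' ht
    have h3 : s * h (diagForm a b x) + t * h (diagForm a b x) = h (diagForm a b x) := by
      rw [← add_mul, hst, one_mul]
    linarith
  · exact key y hy x hx hlt hiff.symm z (segment_symm ℝ x y ▸ hz)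

/-- A small connected part of the free space can be coloured with 16 colours so that points of the
same colour see each other. -/
theorem exists_coloring_freeSpace {P : Set Plane} (hP : IsPolygonalEnvironment P) {δ : ℝ}
    (hδ0 : 0 < δ) (hδ : δ < 1 / 2)
    (hedge : ∀ x y, IsEdge (freeSpace P 1) x y → 4 * δ ≤ dist x y) {o : Plane} {K : Set Plane}
    (hK : IsPreconnected K) (hKF : ∀ x ∈ K, x ∈ freeSpace P 1 ∧ supDist x o ≤ δ) :
    ∃ col : Plane → Bool × Bool → Bool, ∀ x ∈ K, ∀ y ∈ K, col x = col y →
      segment ℝ x y ⊆ freeSpace P 1 := by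
  have hsq : ∀ s : Bool, cond s (1 : ℝ) (-1) * cond s (1 : ℝ) (-1) = 1 := by
    rintro (_ | _) <;> norm_num
  choose w hw using fun st : Bool × Bool =>
    exists_separator hP hδ0 hδ hedge (hsq st.1) (hsq st.2) hK hKF
  refine ⟨fun x st => decide (diagForm (cond st.1 1 (-1)) (cond st.2 1 (-1)) x < w st),
    fun x hx y hy hxy z hz => ?_⟩
  by_contra hzF
  obtain ⟨s, t, hst⟩ := exists_mem_blocked (o := o) hzF
  exact hw (s, t) x hx y hy (decide_eq_decide.1 (congrFun hxy (s, t))) z hz hst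

/-! ### Colouring configurations -/

/-- The linear form attached to one of the four axis directions. -/
def axisForm : Bool × Bool → Plane → ℝ
  | (true, true), p => p 0
  | (true, false), p => -p 0
  | (false, true), p => p 1
  | (false, false), p => -p 1

theorem axisForm_combo (d : Bool × Bool) (s t : ℝ) (p q : Plane) :
    axisForm d (s • p + t • q) = s * axisForm d p + t * axisForm d q := by
  obtain ⟨_ | _, _ | _⟩ := d <;> simp [axisForm] <;> ring

theorem axisForm_sub_le (d : Bool × Bool) (p q : Plane) :
    axisForm d p - axisForm d q ≤ supDist p q := by
  have h0 := abs_le.1 (abs_sub_zero_le_supDist p q)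
  have h1 := abs_le.1 (abs_sub_one_le_supDist p q)
  obtain ⟨_ | _, _ | _⟩ := d <;> simp only [axisForm] <;> linarith [h0.1, h0.2, h1.1, h1.2]

theorem exists_axisForm_sub_eq (p q : Plane) :
    ∃ d, axisForm d p - axisForm d q = supDist p q := by
  unfold supDist
  rcases max_choice |p 0 - q 0| |p 1 - q 1| with h | h <;> rw [h]
  · rcases abs_choice (p 0 - q 0) with h | h <;> rw [h]
    · exact ⟨(true, true), rfl⟩
    · exact ⟨(true, false), by simp only [axisForm]; ring⟩
  · rcases abs_choice (p 1 - q 1) with h | h <;> rw [h]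
    · exact ⟨(false, true), rfl⟩
    · exact ⟨(false, false), by simp only [axisForm]; ring⟩

/-- The cell of the square grid of width 2 that contains a point. -/
noncomputable def gridCell (p : Plane) : ℤ × ℤ := (⌊p 0 / 2⌋, ⌊p 1 / 2⌋)

theorem supDist_lt_of_gridCell_eq {p q : Plane} (h : gridCell p = gridCell q) :
    supDist p q < 2 := by
  simp only [gridCell, Prod.mk.injEq] at h
  refine max_lt ?_ ?_
  · have := Int.abs_sub_lt_one_of_floor_eq_floor h.1
    rw [← sub_div, abs_div, abs_two] at this
    linarith
  · have := Int.abs_sub_lt_one_of_floor_eq_floor h.2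
    rw [← sub_div, abs_div, abs_two] at this
    linarith

theorem exists_fin_floor_eq {x y : ℝ} (h : |x - y| < 3) :
    ∃ e : Fin 5, ⌊y / 2⌋ = ⌊x / 2⌋ + ((e : ℕ) : ℤ) - 2 := by
  rw [abs_lt] at h
  have h1 := Int.floor_le (x / 2)
  have h2 := Int.lt_floor_add_one (x / 2)
  have h3 := Int.floor_le (y / 2)
  have h4 := Int.lt_floor_add_one (y / 2)
  have l1 : ⌊y / 2⌋ < ⌊x / 2⌋ + 3 := by
    have : (⌊y / 2⌋ : ℝ) < (⌊x / 2⌋ : ℝ) + 3 := by linarith [h.1]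
    exact_mod_cast this
  have l2 : ⌊x / 2⌋ - 3 < ⌊y / 2⌋ := by
    have : (⌊x / 2⌋ : ℝ) - 3 < (⌊y / 2⌋ : ℝ) := by linarith [h.2]
    exact_mod_cast this
  -- The cell indices differ by at most 2; the shift by 2 encodes the difference in `Fin 5`.
  refine ⟨⟨(⌊y / 2⌋ - ⌊x / 2⌋ + 2).toNat, by omega⟩, ?_⟩
  simp only
  omega

theorem exists_fin_gridCell_eq {p q : Plane} (h : supDist p q < 3) :
    ∃ e : Fin 5 × Fin 5, gridCell q =
      ((gridCell p).1 + ((e.1 : ℕ) : ℤ) - 2, (gridCell p).2 + ((e.2 : ℕ) : ℤ) - 2) := by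
  obtain ⟨e, he⟩ := exists_fin_floor_eq ((abs_sub_zero_le_supDist p q).trans_lt h)
  obtain ⟨e', he'⟩ := exists_fin_floor_eq ((abs_sub_one_le_supDist p q).trans_lt h)
  exact ⟨(e, e'), Prod.ext he he'⟩

/-- The colours of configurations of `k` robots. -/
abbrev Color (k : ℕ) : Type :=
  Fin k → (Bool × Bool → Bool) × (Fin 5 × Fin 5 → Bool × Bool)

theorem card_color (k : ℕ) : Fintype.card (Color k) = (16 * 4 ^ 25) ^ k := by
  simp [Color]

theorem exists_coloring_freeConfigs {P : Set Plane} (hP : IsPolygonalEnvironment P) {δ : ℝ}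
    (hδ0 : 0 < δ) (hδ : δ < 1 / 2)
    (hedge : ∀ x y, IsEdge (freeSpace P 1) x y → 4 * δ ≤ dist x y) {k : ℕ} {o : Config k}
    {K : Set (Config k)} (hK : IsPreconnected K) (ho : o ∈ K) (hKF : K ⊆ freeConfigs P k 1)
    (hKo : ∀ x ∈ K, ∀ i, supDist (x i) (o i) ≤ δ) :
    ∃ col : Config k → Color k, ∀ x ∈ K, ∀ y ∈ K, col x = col y →
      segment ℝ x y ⊆ freeConfigs P k 1 := by
  classical
  choose colF hcolF using fun i : Fin k =>
    exists_coloring_freeSpace hP hδ0 hδ hedge (o := o i) (K := (fun x : Config k => x i) '' K)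
      (hK.image _ (by fun_prop)) (by
        rintro _ ⟨x, hx, rfl⟩
        exact ⟨(hKF hx).1 i, hKo x hx i⟩)
  choose dir hdir using exists_axisForm_sub_eq
  let Nb (i : Fin k) (e : Fin 5 × Fin 5) (j : Fin k) : Prop := gridCell (o j) =
    ((gridCell (o i)).1 + ((e.1 : ℕ) : ℤ) - 2, (gridCell (o i)).2 + ((e.2 : ℕ) : ℤ) - 2)
  -- Centers are at distance at least 2, so a half-open cell of width 2 holds at most one; the
  -- offset `e` therefore names a robot.
  have hNb : ∀ i e j j', Nb i e j → Nb i e j' → j = j' := by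
    intro i e j j' h h'
    by_contra hne
    have := supDist_lt_of_gridCell_eq (h.trans h'.symm)
    linarith [(hKF ho).2 j j' hne]
  refine ⟨fun x i => (colF i (x i), fun e => if h : ∃ j, Nb i e j then dir (x i) (x h.choose)
    else default), fun x hx y hy hxy z hz => ?_⟩
  have hzi : ∀ i, z i ∈ segment ℝ (x i) (y i) := by
    obtain ⟨s, t, hs, ht, hst, rfl⟩ := hz
    exact fun i => ⟨s, t, hs, ht, hst, rfl⟩
  refine ⟨fun i => ?_, fun i j hij => ?_⟩
  · exact hcolF i _ ⟨x, hx, rfl⟩ _ ⟨y, hy, rfl⟩ (congrArg Prod.fst (congrFun hxy i)) (hzi i)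
  obtain ⟨s, t, hs, ht, hst, rfl⟩ := hz
  simp only [Pi.add_apply, Pi.smul_apply]
  by_cases hfar : supDist (o i) (o j) < 3
  · obtain ⟨e, he⟩ := exists_fin_gridCell_eq hfar
    have hex : ∃ j, Nb i e j := ⟨j, he⟩
    have hj : hex.choose = j := hNb i e _ _ hex.choose_spec he
    have hd : dir (x i) (x j) = dir (y i) (y j) := by
      have := congrFun (congrArg Prod.snd (congrFun hxy i)) e
      simpa only [dif_pos hex, hj] using this
    refine le_trans ?_ (axisForm_sub_le (dir (x i) (x j)) _ _)
    rw [axisForm_combo, axisForm_combo]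
    have h1 := hdir (x i) (x j)
    have h2 := hdir (y i) (y j)
    rw [← hd] at h2
    have h3 := (hKF hx).2 i j hij
    have h4 := (hKF hy).2 i j hij
    rw [← h1] at h3
    rw [← h2] at h4
    have h5 := mul_le_mul_of_nonneg_left h3 hs
    have h6 := mul_le_mul_of_nonneg_left h4 ht
    have h7 : s * (2 * 1) + t * (2 * 1) = 2 * 1 := by rw [← add_mul, hst, one_mul]
    linarith
  -- Robots at distance at least 3 in `o` each move by at most `δ < 1 / 2`, so the axis direction
  -- separating them in `o` works throughout `K`.
  · rw [not_lt] at hfar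
    obtain ⟨d, hd⟩ := exists_axisForm_sub_eq (o i) (o j)
    rw [← hd] at hfar
    refine le_trans ?_ (axisForm_sub_le d _ _)
    rw [axisForm_combo, axisForm_combo]
    have near : ∀ x ∈ K, 2 * 1 ≤ axisForm d (x i) - axisForm d (x j) := by
      intro x hx
      have h1 := (axisForm_sub_le d (o i) (x i)).trans (supDist_comm (o i) (x i) ▸ hKo x hx i)
      have h2 := (axisForm_sub_le d (x j) (o j)).trans (hKo x hx j)
      linarith
    have h5 := mul_le_mul_of_nonneg_left (near x hx) hs
    have h6 := mul_le_mul_of_nonneg_left (near y hy) ht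
    have h7 : s * (2 * 1) + t * (2 * 1) = 2 * 1 := by rw [← add_mul, hst, one_mul]
    linarith

/-! ### Polylines -/

/-- The cost of the first `n` segments of a polyline. -/
noncomputable def polylineCost {k : ℕ} (z : ℕ → Config k) (n : ℕ) : ℝ :=
  ∑ j ∈ Finset.range n, ∑ i, dist (z j i) (z (j + 1) i)

/-- The first `n` segments of a polyline consist of free configurations of unit squares. -/
def IsFreePolyline (P : Set Plane) {k : ℕ} (z : ℕ → Config k) (n : ℕ) : Prop :=
  z 0 ∈ freeConfigs P k 1 ∧ ∀ j < n, segment ℝ (z j) (z (j + 1)) ⊆ freeConfigs P k 1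

theorem polylineCost_succ {k : ℕ} (z : ℕ → Config k) (n : ℕ) :
    polylineCost z (n + 1) = polylineCost z n + ∑ i, dist (z n i) (z (n + 1) i) :=
  Finset.sum_range_succ _ _

theorem polylineCost_nonneg {k : ℕ} (z : ℕ → Config k) (n : ℕ) : 0 ≤ polylineCost z n :=
  Finset.sum_nonneg fun _ _ => Finset.sum_nonneg fun _ _ => dist_nonneg

theorem monotone_polylineCost {k : ℕ} (z : ℕ → Config k) : Monotone (polylineCost z) :=
  monotone_nat_of_le_succ fun n => by
    rw [polylineCost_succ]
    exact le_add_of_nonneg_right (Finset.sum_nonneg fun _ _ => dist_nonneg)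

theorem sum_dist_le_polylineCost_sub {k : ℕ} (z : ℕ → Config k) {a b : ℕ} (hab : a ≤ b) :
    ∑ i, dist (z a i) (z b i) ≤ polylineCost z b - polylineCost z a := by
  induction b, hab using Nat.le_induction with
  | base => simp
  | succ b _ ih =>
    rw [polylineCost_succ]
    have : ∑ i, dist (z a i) (z (b + 1) i) ≤
        ∑ i, dist (z a i) (z b i) + ∑ i, dist (z b i) (z (b + 1) i) := by
      rw [← Finset.sum_add_distrib]
      exact Finset.sum_le_sum fun i _ => dist_triangle _ _ _
    linarith

theorem IsFreePolyline.mem {P : Set Plane} {k : ℕ} {z : ℕ → Config k} {n : ℕ}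
    (h : IsFreePolyline P z n) {j : ℕ} (hj : j ≤ n) : z j ∈ freeConfigs P k 1 := by
  rcases j with _ | j
  · exact h.1
  · exact h.2 j hj (right_mem_segment ℝ _ _)

theorem exists_isPreconnected_polyline {k : ℕ} (z : ℕ → Config k) (j m : ℕ) :
    ∃ K : Set (Config k), IsPreconnected K ∧ (∀ l, j ≤ l → l ≤ j + m → z l ∈ K) ∧
      ∀ x ∈ K, x = z j ∨ ∃ l, j ≤ l ∧ l < j + m ∧ x ∈ segment ℝ (z l) (z (l + 1)) := by
  induction m with
  | zero =>
    refine ⟨{z j}, isPreconnected_singleton, fun l h1 h2 => ?_, fun x hx => Or.inl hx⟩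
    rw [show l = j by omega]
    rfl
  | succ m ih =>
    obtain ⟨K, hK, hmem, hsub⟩ := ih
    refine ⟨K ∪ segment ℝ (z (j + m)) (z (j + m + 1)), hK.union (z (j + m))
      (hmem _ (by omega) le_rfl) (left_mem_segment ℝ _ _)
      (convex_segment _ _).isPreconnected, fun l h1 h2 => ?_, ?_⟩
    · rcases Nat.lt_or_ge (j + m) l with h | h
      · rw [show l = j + m + 1 by omega]
        exact Or.inr (right_mem_segment ℝ _ _)
      · exact Or.inl (hmem l h1 h)
    · rintro x (hx | hx)
      · exact (hsub x hx).imp_right fun ⟨l, h1, h2, h3⟩ => ⟨l, h1, by omega, h3⟩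
      · exact Or.inr ⟨j + m, by omega, by omega, hx⟩

/-- A cheap piece of a polyline with many segments has a shortcut. -/
theorem exists_shortcut {P : Set Plane} (hP : IsPolygonalEnvironment P) {δ : ℝ}
    (hδ0 : 0 < δ) (hδ : δ < 1 / 2)
    (hedge : ∀ x y, IsEdge (freeSpace P 1) x y → 4 * δ ≤ dist x y) {k : ℕ} {z : ℕ → Config k}
    {n : ℕ} (hz : IsFreePolyline P z n) {j : ℕ} (hj : j + 2 * Fintype.card (Color k) ≤ n)
    (hcost : polylineCost z (j + 2 * Fintype.card (Color k)) - polylineCost z j ≤ δ) :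
    ∃ a b, a + 2 ≤ b ∧ b ≤ n ∧ segment ℝ (z a) (z b) ⊆ freeConfigs P k 1 := by
  set m := 2 * Fintype.card (Color k) with hm
  obtain ⟨K, hK, hmem, hsub⟩ := exists_isPreconnected_polyline z j m
  have hdist : ∀ l, j ≤ l → l ≤ j + m → ∀ i, z l i ∈ Metric.closedBall (z j i) δ := by
    intro l h1 h2 i
    rw [Metric.mem_closedBall, dist_comm]
    calc dist (z j i) (z l i) ≤ ∑ i, dist (z j i) (z l i) :=
          Finset.single_le_sum (f := fun i => dist (z j i) (z l i))
            (fun _ _ => dist_nonneg) (Finset.mem_univ i)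
      _ ≤ polylineCost z l - polylineCost z j := sum_dist_le_polylineCost_sub z h1
      _ ≤ δ := le_trans (sub_le_sub_right (monotone_polylineCost z h2) _) hcost
  obtain ⟨col, hcol⟩ := exists_coloring_freeConfigs hP hδ0 hδ hedge (o := z j) hK
    (hmem j le_rfl (by omega)) (fun x hx => by
      rcases hsub x hx with rfl | ⟨l, h1, h2, h3⟩
      · exact hz.mem (by omega)
      · exact hz.2 l (by omega) h3) (fun x hx i => by
      refine (supDist_le_dist _ _).trans (Metric.mem_closedBall.1 ?_)
      rcases hsub x hx with rfl | ⟨l, h1, h2, s, t, hs, ht, hst, rfl⟩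
      · exact Metric.mem_closedBall_self hδ0.le
      · exact convex_closedBall _ _ (hdist l h1 (by omega) i)
          (hdist (l + 1) (by omega) (by omega) i) hs ht hst)
  -- Only every second vertex enters the pigeonhole, so that the chord found skips at least one
  -- vertex.
  obtain ⟨a, b, hab, heq⟩ := Fintype.exists_ne_map_eq_of_card_lt
    (fun l : Fin (Fintype.card (Color k) + 1) => col (z (j + 2 * l))) (by simp)
  wlog hlt : a < b generalizing a b
  · exact this b a hab.symm heq.symm (lt_of_le_of_ne (not_lt.1 hlt) hab.symm)
  have hlt' : (a : ℕ) < b := hlt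
  have hb := b.isLt
  exact ⟨j + 2 * a, j + 2 * b, by omega, by omega,
    hcol _ (hmem _ (by omega) (by omega)) _ (hmem _ (by omega) (by omega)) heq⟩

/-- Replacing a piece of a polyline by a segment. -/
theorem exists_polyline_of_shortcut {P : Set Plane} {k : ℕ} {z : ℕ → Config k} {n a b : ℕ}
    (hz : IsFreePolyline P z n) (hab : a + 2 ≤ b) (hbn : b ≤ n)
    (hseg : segment ℝ (z a) (z b) ⊆ freeConfigs P k 1) :
    ∃ n' < n, ∃ z' : ℕ → Config k, IsFreePolyline P z' n' ∧ z' 0 = z 0 ∧ z' n' = z n ∧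
      polylineCost z' n' ≤ polylineCost z n := by
  set r := b - a - 1 with hr
  set z' : ℕ → Config k := fun l => if l ≤ a then z l else z (l + r) with hz'
  have h1 : ∀ l ≤ a, z' l = z l := fun l hl => if_pos hl
  have h2 : ∀ l, a < l → z' l = z (l + r) := fun l hl => if_neg hl.not_ge
  refine ⟨n - r, by omega, z', ⟨?_, fun l hl => ?_⟩, h1 0 (Nat.zero_le _), ?_, ?_⟩
  · rw [h1 0 (Nat.zero_le _)]; exact hz.1
  · rcases lt_trichotomy l a with h | rfl | h
    · rw [h1 l h.le, h1 (l + 1) h]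
      exact hz.2 l (by omega)
    · rw [h1 l le_rfl, h2 (l + 1) (by omega), show l + 1 + r = b by omega]
      exact hseg
    · rw [h2 l h, h2 (l + 1) (by omega), show l + 1 + r = l + r + 1 by omega]
      exact hz.2 _ (by omega)
  · rw [h2 _ (by omega), show n - r + r = n by omega]
  · have e1 : ∀ l ≤ a, polylineCost z' l = polylineCost z l := fun l hl =>
      Finset.sum_congr rfl fun i hi => by
        have := Finset.mem_range.1 hi
        rw [h1 i (by omega), h1 (i + 1) (by omega)]
    have e2 : polylineCost z' (a + 1) ≤ polylineCost z b := by
      rw [polylineCost_succ, e1 a le_rfl, h1 a le_rfl, h2 (a + 1) (by omega),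
        show a + 1 + r = b by omega]
      linarith [sum_dist_le_polylineCost_sub z (show a ≤ b by omega)]
    have e3 : ∀ l, a + 1 ≤ l → polylineCost z' l ≤ polylineCost z (l + r) := by
      intro l hl
      induction l, hl using Nat.le_induction with
      | base => rw [show a + 1 + r = b by omega]; exact e2
      | succ l hl ih =>
        rw [polylineCost_succ, show l + 1 + r = l + r + 1 by omega, polylineCost_succ,
          h2 l (by omega), h2 (l + 1) (by omega), show l + 1 + r = l + r + 1 by omega]
        linarith
    have := e3 (n - r) (by omega)
    rwa [show n - r + r = n by omega] at this

theorem exists_short_polyline {P : Set Plane} (hP : IsPolygonalEnvironment P) {δ : ℝ}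
    (hδ0 : 0 < δ) (hδ : δ < 1 / 2)
    (hedge : ∀ x y, IsEdge (freeSpace P 1) x y → 4 * δ ≤ dist x y) {k : ℕ} (n : ℕ)
    (z : ℕ → Config k) (hz : IsFreePolyline P z n) :
    ∃ (n' : ℕ) (z' : ℕ → Config k), IsFreePolyline P z' n' ∧ z' 0 = z 0 ∧ z' n' = z n ∧
      polylineCost z' n' ≤ polylineCost z n ∧
      (n' : ℝ) + 1 ≤ 2 * Fintype.card (Color k) / δ * (polylineCost z' n' + 1) := by
  induction n using Nat.strong_induction_on generalizing z with
  | _ n ih =>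
    by_cases hex : ∃ a b, a + 2 ≤ b ∧ b ≤ n ∧ segment ℝ (z a) (z b) ⊆ freeConfigs P k 1
    · obtain ⟨a, b, hab, hbn, hseg⟩ := hex
      obtain ⟨n₁, hn₁, z₁, hz₁, h0, h1, hc⟩ := exists_polyline_of_shortcut hz hab hbn hseg
      obtain ⟨n', z', hz', h0', h1', hc', hb⟩ := ih n₁ hn₁ z₁ hz₁
      exact ⟨n', z', hz', h0'.trans h0, h1'.trans h1, hc'.trans hc, hb⟩
    · refine ⟨n, z, hz, rfl, rfl, le_rfl, ?_⟩
      set L := Fintype.card (Color k) with hL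
      have hLpos : 0 < L := Fintype.card_pos
      -- Without shortcuts, each of the consecutive windows of `2 * L` segments costs more than `δ`.
      have hwin : ∀ M, 2 * L * M ≤ n → M * δ ≤ polylineCost z (2 * L * M) := by
        intro M
        induction M with
        | zero => intro _; simpa using polylineCost_nonneg z 0
        | succ M ihM =>
          intro hM
          have hM' : 2 * L * M + 2 * L ≤ n := by linarith
          have h1 := ihM (by omega)
          have h2 : δ < polylineCost z (2 * L * M + 2 * L) - polylineCost z (2 * L * M) := by
            by_contra! hle
            exact hex (exists_shortcut hP hδ0 hδ hedge hz hM' hle)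
          rw [show 2 * L * (M + 1) = 2 * L * M + 2 * L by ring]
          push_cast
          linarith
      have h1 := hwin (n / (2 * L)) (Nat.mul_div_le _ _)
      have h2 := h1.trans (monotone_polylineCost z (Nat.mul_div_le n (2 * L)))
      have h3 : n + 1 ≤ 2 * L * (n / (2 * L) + 1) := Nat.lt_mul_div_succ n (by omega)
      have h4 : (n : ℝ) + 1 ≤ 2 * L * ((n / (2 * L) : ℕ) + 1) := by exact_mod_cast h3
      -- The incomplete last window accounts for one more `δ`, which is less than 1.
      have h5 : (((n / (2 * L) : ℕ) : ℝ) + 1) * δ ≤ polylineCost z n + 1 := by linarith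
      calc (n : ℝ) + 1 ≤ 2 * L * ((n / (2 * L) : ℕ) + 1) := h4
        _ = 2 * L / δ * ((((n / (2 * L) : ℕ) : ℝ) + 1) * δ) := by field_simp
        _ ≤ 2 * L / δ * (polylineCost z n + 1) := by gcongr

/-! ### From polylines to plans -/

theorem eVariationOn_segment (p q : Plane) (j : ℝ) :
    eVariationOn (fun τ : ℝ => p + (τ - j) • (q - p)) (Icc j (j + 1)) = edist p q := by
  refine le_antisymm ?_ ?_
  · have hlip : LipschitzOnWith (nndist p q) (fun τ : ℝ => p + (τ - j) • (q - p))
        (Icc j (j + 1)) := by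
      refine LipschitzOnWith.of_dist_le_mul fun x _ y _ => le_of_eq ?_
      rw [dist_add_left, dist_eq_norm, ← sub_smul, norm_smul, coe_nndist, dist_comm p q,
        dist_eq_norm, Real.dist_eq, mul_comm, Real.norm_eq_abs]
      congr 2
      ring
    have h1 := hlip.comp_eVariationOn_le (f := fun τ : ℝ => p + (τ - j) • (q - p)) (g := id)
      (s := Icc j (j + 1)) (fun _ h => h)
    have h2 : eVariationOn (id : ℝ → ℝ) (Icc j (j + 1)) ≤ 1 := by
      have := (monotone_id.monotoneOn (Icc j (j + 1))).eVariationOn_eq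
        (left_mem_Icc.2 (by linarith : j ≤ j + 1)) (right_mem_Icc.2 (by linarith : j ≤ j + 1))
      rw [inter_self, id, id, add_sub_cancel_left, ENNReal.ofReal_one] at this
      exact this.le
    calc _ ≤ (nndist p q : ℝ≥0∞) * eVariationOn (id : ℝ → ℝ) (Icc j (j + 1)) := h1
      _ ≤ (nndist p q : ℝ≥0∞) * 1 := by gcongr
      _ = edist p q := by rw [mul_one, edist_nndist]
  · have := eVariationOn.edist_le (fun τ : ℝ => p + (τ - j) • (q - p))
      (left_mem_Icc.2 (by linarith : j ≤ j + 1)) (right_mem_Icc.2 (by linarith : j ≤ j + 1))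
    simp only [sub_self, zero_smul, add_zero, add_sub_cancel_left, one_smul,
      add_sub_cancel] at this
    exact this

/-- The plan that traverses the `j`-th segment of a polyline in the time interval
`[j, j + 1]`. -/
noncomputable def polylinePlan {k : ℕ} (z : ℕ → Config k) (τ : ℝ) : Config k :=
  z ⌊τ⌋₊ + (τ - ⌊τ⌋₊) • (z (⌊τ⌋₊ + 1) - z ⌊τ⌋₊)

theorem polylinePlan_eq {k : ℕ} (z : ℕ → Config k) {j : ℕ} {τ : ℝ}
    (hτ : τ ∈ Icc (j : ℝ) (j + 1)) :
    polylinePlan z τ = z j + (τ - j) • (z (j + 1) - z j) := by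
  unfold polylinePlan
  rcases hτ.2.lt_or_eq with h | rfl
  · rw [(Nat.floor_eq_iff ((Nat.cast_nonneg j).trans hτ.1)).2 ⟨hτ.1, h⟩]
  · have : ⌊(j : ℝ) + 1⌋₊ = j + 1 := by exact_mod_cast Nat.floor_natCast (R := ℝ) (j + 1)
    rw [this]
    push_cast
    simp

theorem polylinePlan_natCast {k : ℕ} (z : ℕ → Config k) (j : ℕ) : polylinePlan z j = z j := by
  rw [polylinePlan_eq z (left_mem_Icc.2 (by linarith : (j : ℝ) ≤ j + 1))]
  simp

theorem continuousOn_polylinePlan {k : ℕ} (z : ℕ → Config k) (n : ℕ) :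
    ContinuousOn (polylinePlan z) (Icc 0 n) := by
  induction n with
  | zero => simp
  | succ n ih =>
    have h : ContinuousOn (polylinePlan z) (Icc (n : ℝ) (n + 1)) := by
      refine ContinuousOn.congr (f := fun τ : ℝ => z n + (τ - n) • (z (n + 1) - z n)) ?_
        fun τ hτ => polylinePlan_eq z hτ
      fun_prop
    have := ih.union_of_isClosed h isClosed_Icc isClosed_Icc
    rw [Icc_union_Icc_eq_Icc (Nat.cast_nonneg n) (by linarith)] at this
    exact_mod_cast this

theorem exists_mem_Icc_nat {n : ℕ} {τ : ℝ} (hτ : τ ∈ Icc (0 : ℝ) n) :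
    τ = n ∨ ∃ j < n, τ ∈ Ico (j : ℝ) (j + 1) := by
  rcases hτ.2.eq_or_lt with h | h
  · exact Or.inl h
  · exact Or.inr ⟨⌊τ⌋₊, (Nat.floor_lt hτ.1).2 h, Nat.floor_le hτ.1, Nat.lt_floor_add_one τ⟩

theorem isFeasiblePlan_polylinePlan {P : Set Plane} {k n : ℕ} {z : ℕ → Config k}
    (hz : IsFreePolyline P z n) : IsFeasiblePlan P 1 (z 0) (z n) n (polylinePlan z) := by
  have hfree : ∀ τ ∈ Icc (0 : ℝ) n, polylinePlan z τ ∈ freeConfigs P k 1 := by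
    intro τ hτ
    rcases exists_mem_Icc_nat hτ with rfl | ⟨j, hj, hτj⟩
    · rw [polylinePlan_natCast]
      exact hz.mem le_rfl
    · rw [polylinePlan_eq z (Ico_subset_Icc_self hτj)]
      refine hz.2 j hj ?_
      rw [segment_eq_image']
      exact ⟨τ - j, ⟨by linarith [hτj.1], by linarith [hτj.2]⟩, rfl⟩
  refine ⟨⟨Nat.cast_nonneg n, continuousOn_polylinePlan z n, fun τ hτ i => ?_, ?_, ?_⟩, hfree⟩
  · exact (hfree τ hτ).1 i _ (by rw [supDist_self]; exact zero_le_one)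
  · exact_mod_cast polylinePlan_natCast z 0
  · exact polylinePlan_natCast z n

theorem isPiecewiseLinear_polylinePlan {k : ℕ} (z : ℕ → Config k) (n : ℕ) :
    IsPiecewiseLinear n (polylinePlan z) := by
  refine ⟨n, fun j => j, Nat.mono_cast, Nat.cast_zero, rfl, fun j _ =>
    ⟨z j - (j : ℝ) • (z (j + 1) - z j), z (j + 1) - z j, fun x hx => ?_⟩⟩
  rw [polylinePlan_eq z (by exact_mod_cast hx), sub_smul]
  abel

theorem cost_polylinePlan {k : ℕ} (z : ℕ → Config k) (n : ℕ) :
    cost n (polylinePlan z) = ENNReal.ofReal (polylineCost z n) := by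
  induction n with
  | zero =>
    simp only [cost, polylineCost, Nat.cast_zero, Icc_self, Finset.range_zero, Finset.sum_empty,
      ENNReal.ofReal_zero]
    exact Finset.sum_eq_zero fun i _ => eVariationOn.subsingleton _ subsingleton_singleton
  | succ n ih =>
    rw [polylineCost_succ, ENNReal.ofReal_add (polylineCost_nonneg z n)
      (Finset.sum_nonneg fun _ _ => dist_nonneg), ← ih,
      ENNReal.ofReal_sum_of_nonneg fun _ _ => dist_nonneg]
    unfold cost
    rw [← Finset.sum_add_distrib]
    refine Finset.sum_congr rfl fun i _ => ?_
    have h1 := eVariationOn.Icc_add_Icc (fun τ => polylinePlan z τ i) (s := univ)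
      (Nat.cast_nonneg (α := ℝ) n) (by linarith : (n : ℝ) ≤ n + 1) (mem_univ _)
    simp only [univ_inter] at h1
    have h2 : eVariationOn (fun τ => polylinePlan z τ i) (Icc (n : ℝ) (n + 1)) =
        edist (z n i) (z (n + 1) i) := by
      rw [← eVariationOn_segment _ _ (n : ℝ)]
      refine eVariationOn.congr fun τ hτ => ?_
      rw [polylinePlan_eq z hτ]
      rfl
    rw [← edist_dist, ← h2, h1]
    push_cast
    rfl

theorem numBreakpoints_polylinePlan_le {k : ℕ} (z : ℕ → Config k) (n : ℕ) :
    numBreakpoints n (polylinePlan z) ≤ n + 1 := by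
  have hsub : breakpoints n (polylinePlan z) ⊆
      (Finset.range (n + 1)).image (Nat.cast : ℕ → ℝ) := by
    rintro τ ⟨hτ, h⟩
    rw [Finset.coe_image]
    by_contra hno
    have hnat : ∀ j ≤ n, τ ≠ j := fun j hj e =>
      hno ⟨j, Finset.mem_coe.2 (Finset.mem_range.2 (by omega)), e.symm⟩
    rcases h with h | h | h
    · exact hnat 0 (Nat.zero_le n) (by simpa using h)
    · exact hnat n le_rfl h
    · rcases exists_mem_Icc_nat hτ with h' | ⟨j, hj, hτj⟩
      · exact hnat n le_rfl h'
      · refine h ⟨z j - (j : ℝ) • (z (j + 1) - z j), z (j + 1) - z j, ?_⟩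
        filter_upwards [Ioo_mem_nhds (hτj.1.lt_of_ne' (hnat j hj.le)) hτj.2] with x hx
        rw [polylinePlan_eq z (Ioo_subset_Icc_self hx), sub_smul]
        abel
  calc numBreakpoints n (polylinePlan z)
      ≤ ((Finset.range (n + 1)).image (Nat.cast : ℕ → ℝ) : Set ℝ).encard := encard_le_encard hsub
    _ = ((Finset.range (n + 1)).image (Nat.cast : ℕ → ℝ)).card := encard_coe_eq_coe_finsetCard _
    _ ≤ ((n + 1 : ℕ) : ℕ∞) := by
      exact_mod_cast Finset.card_image_le.trans (Finset.card_range (n + 1)).le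
    _ = n + 1 := by push_cast; rfl

/-! ### From robust plans to polylines -/

/-- By uniform continuity, fine samples have chords within `ρ` of a configuration that is free for
radius `1 + ρ`. Moving every robot by at most `ρ` keeps such a configuration free for radius 1. -/
theorem IsFeasiblePlan.exists_polyline {P : Set Plane} {k : ℕ} {ρ : ℝ} (hρ : 0 < ρ)
    {s t : Config k} {T : ℝ} {π : ℝ → Config k} (h : IsFeasiblePlan P (1 + ρ) s t T π) :
    ∃ (n : ℕ) (z : ℕ → Config k), IsFreePolyline P z n ∧ z 0 = s ∧ z n = t ∧
      ENNReal.ofReal (polylineCost z n) ≤ cost T π := by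
  obtain ⟨hplan, hfree⟩ := h
  have hT := hplan.nonneg
  obtain ⟨η, hη, hunif⟩ := Metric.uniformContinuousOn_iff.1
    (isCompact_Icc.uniformContinuousOn_of_continuous hplan.continuousOn) ρ hρ
  obtain ⟨n, hn⟩ := exists_nat_gt (T / η)
  have hn0 : (0 : ℝ) < n := (div_nonneg hT hη.le).trans_lt hn
  have hstep : T / n < η := by
    rw [div_lt_iff₀ hn0]
    rw [div_lt_iff₀ hη] at hn
    linarith
  set u : ℕ → ℝ := fun j => j * (T / n) with hu
  have hq : 0 ≤ T / n := div_nonneg hT hn0.le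
  have humem : ∀ j ≤ n, u j ∈ Icc 0 T := by
    intro j hj
    refine ⟨mul_nonneg (Nat.cast_nonneg j) hq, ?_⟩
    calc (j : ℝ) * (T / n) ≤ n * (T / n) := by gcongr
      _ = T := mul_div_cancel₀ T hn0.ne'
  have hclose : ∀ j < n, ∀ x ∈ segment ℝ (π (u j)) (π (u (j + 1))), ∀ i,
      supDist (x i) (π (u j) i) ≤ ρ := by
    intro j hj x hx i
    have hd : dist (π (u (j + 1))) (π (u j)) < ρ := by
      refine hunif _ (humem _ hj) _ (humem _ hj.le) ?_
      rw [Real.dist_eq]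
      simp only [hu]
      push_cast
      rw [show ((j : ℝ) + 1) * (T / n) - j * (T / n) = T / n by ring, abs_of_nonneg hq]
      exact hstep
    have hball : x ∈ Metric.closedBall (π (u j)) ρ :=
      (convex_closedBall _ _).segment_subset (Metric.mem_closedBall_self hρ.le)
        (Metric.mem_closedBall.2 hd.le) hx
    exact (supDist_le_dist _ _).trans ((dist_le_pi_dist _ _ i).trans hball)
  have hrobust : ∀ y ∈ freeConfigs P k (1 + ρ), ∀ x : Config k, (∀ i, supDist (x i) (y i) ≤ ρ) →
      x ∈ freeConfigs P k 1 := by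
    intro y hy x hxy
    refine ⟨fun i q hq => hy.1 i q ?_, fun i j hij => ?_⟩
    · have := supDist_triangle (y i) (x i) q
      rw [supDist_comm (y i) (x i)] at this
      linarith [hxy i]
    · have h1 := supDist_triangle (y i) (x i) (y j)
      have h2 := supDist_triangle (x i) (x j) (y j)
      rw [supDist_comm (y i) (x i)] at h1
      linarith [hxy i, hxy j, hy.2 i j hij]
  refine ⟨n, fun j => π (u j), ⟨?_, fun j hj x hx => ?_⟩, ?_, ?_, ?_⟩
  · exact hrobust _ (hfree _ (humem 0 (Nat.zero_le n))) _ fun i => by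
      rw [supDist_self]; exact hρ.le
  · exact hrobust _ (hfree _ (humem j hj.le)) _ (hclose j hj x hx)
  · simp only [hu, Nat.cast_zero, zero_mul]
    exact hplan.source
  · simp only [hu]
    rw [mul_div_cancel₀ T hn0.ne']
    exact hplan.target
  · unfold polylineCost cost
    rw [Finset.sum_comm, ENNReal.ofReal_sum_of_nonneg fun _ _ =>
      Finset.sum_nonneg fun _ _ => dist_nonneg]
    refine Finset.sum_le_sum fun i _ => ?_
    rw [ENNReal.ofReal_sum_of_nonneg fun _ _ => dist_nonneg]
    refine le_trans (le_of_eq ?_) (eVariationOn.sum_le_of_monotoneOn_Iic (n := n) (u := u)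
      (f := fun τ => π τ i) (s := Icc 0 T) ?_ humem)
    · refine Finset.sum_congr rfl fun j _ => ?_
      rw [edist_dist, dist_comm]
    · intro a _ b _ hab
      simp only [hu]
      gcongr

/-! ### Compactness -/

theorem isClosed_freeConfigs {P : Set Plane} (hP : IsClosed P) (k : ℕ) (r : ℝ) :
    IsClosed (freeConfigs P k r) := by
  have : freeConfigs P k r = (⋂ i, (fun p : Config k => p i) ⁻¹' freeSpace P r) ∩
      ⋂ i, ⋂ j, ⋂ _ : i ≠ j, {p : Config k | 2 * r ≤ supDist (p i) (p j)} := by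
    ext p
    simp [freeConfigs]
  rw [this]
  refine (isClosed_iInter fun i => (isClosed_freeSpace hP r).preimage (by fun_prop)).inter
    (isClosed_iInter fun i => isClosed_iInter fun j => isClosed_iInter fun _ => ?_)
  exact isClosed_le continuous_const
    (continuous_supDist.comp (by fun_prop : Continuous fun p : Config k => (p i, p j)))

theorem isClosed_setOf_isFreePolyline {P : Set Plane} (hP : IsClosed P) (k n : ℕ) :
    IsClosed {z : ℕ → Config k | IsFreePolyline P z n} := by
  have : {z : ℕ → Config k | IsFreePolyline P z n} =
      ((fun z => z 0) ⁻¹' freeConfigs P k 1) ∩ ⋂ j : Fin n, ⋂ θ : Icc (0 : ℝ) 1,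
        (fun z => z j + (θ : ℝ) • (z (j + 1) - z j)) ⁻¹' freeConfigs P k 1 := by
    ext z
    simp only [IsFreePolyline, segment_eq_image', mem_ofPred_eq, image_subset_iff, mem_inter_iff,
      mem_preimage, mem_iInter, Subtype.forall, Fin.forall_iff]
    rfl
  rw [this]
  have hc := isClosed_freeConfigs hP k 1
  exact (hc.preimage (by fun_prop)).inter (isClosed_iInter fun j => isClosed_iInter fun θ =>
    hc.preimage (by fun_prop))

theorem continuous_polylineCost (k n : ℕ) :
    Continuous fun z : ℕ → Config k => polylineCost z n := by
  unfold polylineCost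
  fun_prop

/-- If the cost bound `C` can be approximated by polylines with few segments, then it can be
attained by such a polyline. -/
theorem exists_polyline_cost_le {P : Set Plane} (hP : IsClosed P) {k : ℕ} {s t : Config k}
    {C B : ℝ} (hB : 0 ≤ B)
    (h : ∀ ε > 0, ∃ (n : ℕ) (z : ℕ → Config k), IsFreePolyline P z n ∧ z 0 = s ∧ z n = t ∧
      polylineCost z n ≤ C + ε ∧ (n : ℝ) + 1 ≤ B * (polylineCost z n + 1)) :
    ∃ (n : ℕ) (z : ℕ → Config k), IsFreePolyline P z n ∧ z 0 = s ∧ z n = t ∧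
      polylineCost z n ≤ C ∧ (n : ℝ) + 1 ≤ B * (polylineCost z n + 1) := by
  let A (n : ℕ) (ε : ℝ) : Set (ℕ → Config k) := {z | IsFreePolyline P z n ∧ z 0 = s ∧ z n = t ∧
    polylineCost z n ≤ C + ε ∧ (n : ℝ) + 1 ≤ B * (polylineCost z n + 1)}
  have hAmono : ∀ n ε ε', ε ≤ ε' → A n ε ⊆ A n ε' := fun n ε ε' hle z ⟨h1, h2, h3, h4, h5⟩ =>
    ⟨h1, h2, h3, h4.trans (by linarith), h5⟩
  -- For `ε < 1` the number of segments is at most `N`. As the families `A n ε` grow with `ε`, a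
  -- single `n` must serve all `ε`.
  obtain ⟨N, hN⟩ := exists_nat_ge (B * (C + 2))
  obtain ⟨n, hn⟩ : ∃ n, ∀ ε > 0, (A n ε).Nonempty := by
    by_contra! hcon
    choose e he hemp using hcon
    have hev : ∀ᶠ ε in 𝓝[>] (0 : ℝ), ε < 1 ∧ ∀ n ∈ Iic N, ε < e n :=
      (Eventually.and (Iio_mem_nhds one_pos) ((eventually_all_finite (finite_Iic N)).2
        fun n _ => Iio_mem_nhds (he n))).filter_mono nhdsWithin_le_nhds
    obtain ⟨ε, ⟨hε1, hεe⟩, hε⟩ := (hev.and self_mem_nhdsWithin).exists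
    obtain ⟨n, z, hz⟩ := h ε hε
    have hnN : n ≤ N := by
      have h1 : (n : ℝ) + 1 ≤ B * (C + 2) :=
        hz.2.2.2.2.trans (mul_le_mul_of_nonneg_left (by linarith [hz.2.2.2.1]) hB)
      have h2 : (n : ℝ) ≤ N := by linarith
      exact_mod_cast h2
    have hmem : z ∈ A n (e n) := hAmono n ε _ (hεe n hnN).le hz
    rw [hemp n] at hmem
    exact hmem
  let Z : Set (ℕ → Config k) := univ.pi (fun _ => Metric.closedBall s (C + 1)) ∩ A n 1
  have hZ : IsCompact Z := by
    refine (isCompact_univ_pi fun _ => isCompact_closedBall s (C + 1)).inter_right ?_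
    refine (isClosed_setOf_isFreePolyline hP k n).inter (IsClosed.inter ?_ (IsClosed.inter ?_
      (IsClosed.inter ?_ ?_)))
    · exact isClosed_eq (by fun_prop) continuous_const
    · exact isClosed_eq (by fun_prop) continuous_const
    · exact isClosed_le (continuous_polylineCost k n) continuous_const
    · exact isClosed_le continuous_const
        (continuous_const.mul ((continuous_polylineCost k n).add continuous_const))
  have hZne : ∀ ε, 0 < ε → ε ≤ 1 → ∃ z ∈ Z, polylineCost z n ≤ C + ε := by
    intro ε hε hε1
    obtain ⟨z, hz, h0, h1, hc, hb⟩ := hn ε hε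
    -- Freezing the sequence after index `n` keeps all its terms in the ball, as membership in the
    -- compact product `Z` demands.
    have hcost : ∀ m ≤ n, polylineCost (fun j => z (min j n)) m = polylineCost z m := by
      intro m hm
      refine Finset.sum_congr rfl fun j hj => ?_
      have := Finset.mem_range.1 hj
      simp only [min_eq_left (show j ≤ n by omega), min_eq_left (show j + 1 ≤ n by omega)]
    refine ⟨fun j => z (min j n), ⟨fun j _ => ?_, ⟨?_, fun j hj => ?_⟩, ?_, ?_, ?_, ?_⟩, ?_⟩
    · have hle := sum_dist_le_polylineCost_sub z (Nat.zero_le (min j n))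
      have hle' := monotone_polylineCost z (min_le_right j n)
      have hz0 : polylineCost z 0 = 0 := by simp [polylineCost]
      rw [Metric.mem_closedBall, dist_comm, ← h0, dist_pi_le_iff (by
        linarith [polylineCost_nonneg z n])]
      intro i
      have := Finset.single_le_sum (f := fun i => dist (z 0 i) (z (min j n) i))
        (fun _ _ => dist_nonneg) (Finset.mem_univ i)
      linarith
    · simpa using hz.1
    · simp only [min_eq_left hj.le, min_eq_left (show j + 1 ≤ n from hj)]
      exact hz.2 j hj
    · simpa using h0
    · simpa using h1
    · rw [hcost n le_rfl]
      linarith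
    · rw [hcost n le_rfl]
      exact hb
    · rw [hcost n le_rfl]
      exact hc
  obtain ⟨z₁, hz₁, -⟩ := hZne 1 one_pos le_rfl
  obtain ⟨z, hz, hmin⟩ := hZ.exists_isMinOn ⟨z₁, hz₁⟩ (continuous_polylineCost k n).continuousOn
  obtain ⟨-, h1, h2, h3, -, h5⟩ := hz
  refine ⟨n, z, h1, h2, h3, le_of_forall_pos_le_add fun ε hε => ?_, h5⟩
  obtain ⟨z', hz', hc'⟩ := hZne (min ε 1) (lt_min hε one_pos) (min_le_right _ _)
  have hle : polylineCost z n ≤ polylineCost z' n := hmin hz'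
  linarith [min_le_left ε 1]

end SquareRobots

/-! ### Assembling the corollary -/

theorem mainTheorem6 (c : ℝ) (hc : 1 ≤ c) :
    ∃ f : ℕ → ℝ≥0, (∃ A B : ℝ≥0, ∀ k : ℕ, f k ≤ A * B ^ k) ∧
      ∀ (k : ℕ) (ρ : ℝ) (P : Set SquareRobots.Plane) (s t : SquareRobots.Config k),
        0 < ρ →
        SquareRobots.IsPolygonalEnvironment P →
        (∀ a b, SquareRobots.IsEdge (SquareRobots.freeSpace P 1) a b → 1 / c ≤ dist a b) →
        SquareRobots.IsRobustlyReachable P ρ s t →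
        ∃ (T : ℝ) (π : ℝ → SquareRobots.Config k),
          SquareRobots.IsFeasiblePlan P 1 s t T π ∧
          SquareRobots.IsPiecewiseLinear T π ∧
          SquareRobots.cost T π ≤ SquareRobots.opt P s t (1 + ρ) ∧
          (SquareRobots.numBreakpoints T π : ℝ≥0∞) ≤
            (f k : ℝ≥0∞) * (SquareRobots.cost T π + 1) := by
  open SquareRobots in
  have hc0 : 0 < c := one_pos.trans_le hc
  -- With `δ = 1 / (4 * c)` the segment bound has constant `2 * L / δ = 8 * c * L`, where `L = (16 *
  -- 4 ^ 25) ^ k`.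
  let A : ℝ≥0 := ⟨8 * c, by positivity⟩
  refine ⟨fun k => A * (16 * 4 ^ 25) ^ k, ⟨A, 16 * 4 ^ 25, fun k => le_rfl⟩, ?_⟩
  intro k ρ P s t hρ hP hedge hreach
  set δ : ℝ := 1 / (4 * c) with hδ
  have hδ0 : 0 < δ := by positivity
  have hδ2 : δ < 1 / 2 := by
    rw [hδ, div_lt_div_iff₀ (by positivity) two_pos]
    linarith
  have hedge' : ∀ x y, IsEdge (freeSpace P 1) x y → 4 * δ ≤ dist x y := by
    intro x y h
    have e : 4 * δ = 1 / c := by rw [hδ]; field_simp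
    rw [e]
    exact hedge x y h
  set B : ℝ := 2 * Fintype.card (Color k) / δ with hB
  have hB0 : 0 ≤ B := by positivity
  have hBf : ENNReal.ofReal B = ((A * (16 * 4 ^ 25) ^ k : ℝ≥0) : ℝ≥0∞) := by
    rw [ENNReal.ofReal, ENNReal.coe_inj]
    refine NNReal.eq ?_
    rw [Real.coe_toNNReal B hB0, hB, hδ, card_color]
    push_cast
    change _ = 8 * c * _
    field_simp
    ring
  -- few segments suffice for every robust plan
  have hplan : ∀ T π, IsFeasiblePlan P (1 + ρ) s t T π →
      ∃ (n : ℕ) (z : ℕ → Config k), IsFreePolyline P z n ∧ z 0 = s ∧ z n = t ∧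
        ENNReal.ofReal (polylineCost z n) ≤ cost T π ∧
        (n : ℝ) + 1 ≤ B * (polylineCost z n + 1) := by
    intro T π h
    obtain ⟨n, z, hz, h0, h1, hcost⟩ := h.exists_polyline hρ
    obtain ⟨n', z', hz', h0', h1', hcost', hn'⟩ :=
      exists_short_polyline hP hδ0 hδ2 hedge' n z hz
    exact ⟨n', z', hz', h0'.trans h0, h1'.trans h1,
      (ENNReal.ofReal_le_ofReal hcost').trans hcost, hn'⟩
  have key : ∃ (n : ℕ) (z : ℕ → Config k), IsFreePolyline P z n ∧ z 0 = s ∧ z n = t ∧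
      ENNReal.ofReal (polylineCost z n) ≤ opt P s t (1 + ρ) ∧
      (n : ℝ) + 1 ≤ B * (polylineCost z n + 1) := by
    by_cases htop : opt P s t (1 + ρ) = ⊤
    · obtain ⟨T, π, -, h⟩ := hreach
      obtain ⟨n, z, hz, h0, h1, -, hn⟩ := hplan T π h
      exact ⟨n, z, hz, h0, h1, by rw [htop]; exact le_top, hn⟩
    · obtain ⟨n, z, hz, h0, h1, hcost, hn⟩ := exists_polyline_cost_le hP.1 (s := s) (t := t)
        (C := (opt P s t (1 + ρ)).toReal) hB0 fun ε hε => by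
          have hlt : opt P s t (1 + ρ) < opt P s t (1 + ρ) + ENNReal.ofReal ε :=
            ENNReal.lt_add_right htop (by simpa using hε)
          obtain ⟨T, hT⟩ := iInf_lt_iff.1 hlt
          obtain ⟨π, hπ⟩ := iInf_lt_iff.1 hT
          obtain ⟨hfeas, hcost⟩ := iInf_lt_iff.1 hπ
          obtain ⟨n, z, hz, h0, h1, hc', hn⟩ := hplan T π hfeas
          refine ⟨n, z, hz, h0, h1, ?_, hn⟩
          rw [← ENNReal.ofReal_le_ofReal_iff (by positivity),
            ENNReal.ofReal_add ENNReal.toReal_nonneg hε.le, ENNReal.ofReal_toReal htop]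
          exact hc'.trans hcost.le
      exact ⟨n, z, hz, h0, h1, (ENNReal.ofReal_le_ofReal hcost).trans
        (ENNReal.ofReal_toReal htop).le, hn⟩
  obtain ⟨n, z, hz, rfl, rfl, hcost, hn⟩ := key
  refine ⟨n, polylinePlan z, isFeasiblePlan_polylinePlan hz, isPiecewiseLinear_polylinePlan z n,
    ?_, ?_⟩
  · rw [cost_polylinePlan]
    exact hcost
  · rw [cost_polylinePlan, ← hBf, ← ENNReal.ofReal_one,
      ← ENNReal.ofReal_add (polylineCost_nonneg z n) zero_le_one, ← ENNReal.ofReal_mul hB0]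
    calc ((numBreakpoints n (polylinePlan z) : ℕ∞) : ℝ≥0∞) ≤ ((n + 1 : ℕ∞) : ℝ≥0∞) :=
          ENat.toENNReal_le.2 (numBreakpoints_polylinePlan_le z n)
      _ = ENNReal.ofReal ((n : ℝ) + 1) := by
        rw [ENNReal.ofReal_add (Nat.cast_nonneg n) zero_le_one]
        simp
      _ ≤ ENNReal.ofReal (B * (polylineCost z n + 1)) := ENNReal.ofReal_le_ofReal hn
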